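/- Let $f:\mathbb{C}\to\mathbb{C}$ be a transcendental entire function (entire and not a polynomial), and let $f^n$ denote its $n$-th iterate. For $r>0$ put $M(r,f)=\max_{|z|=r}|f(z)|$, and let $M^n(r,f)$ denote the $n$-th iterate of $r\mapsto M(r,f)$. Let $R>0$ be such that $M(r,f)>r$ for all $r\ge R$, and define $$A_R(f)=\{z\in\mathbb{C}: |f^n(z)|\ge M^n(R,f)\text{ for all } n\ge 0\},$$ $$A(f)=\{z\in\mathbb{C}: \text{there is } L\ge 0 \text{ with } |f^{n+L}(z)|\ge M^n(R,f)\text{ for all } n\ge 0\},$$ $$I(f)=\{z\in\mathbb{C}: f^n(z)\to\infty\text{ as } n\to\infty\};$$ in the definition of $A(f)$ the number $R$ may be replaced by any $S>0$ such that $M(r,f)>r$ for all $r\ge S$. A set $E\subset\mathbb{C}$ is called an (infinite) spider's web if $E$ is connected and there is a sequence of bounded simply connected domains $G_n$, $n\in\mathbb{N}$, with $G_n\subset G_{n+1}$ and $\partial G_n\subset E$ for all $n$, and $\bigcup_{n}G_n=\mathbb{C}$. Theorem. If the complement $\mathbb{C}\setminus A_R(f)$ has a bounded connected component, then each of $A_R(f)$,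 $A(f)$ and $I(f)$ is an (infinite) spider's web. -/

import Mathlib

open Filter Topology

namespace FastEscaping

/-- A transcendental entire function: holomorphic on `ℂ` and not a polynomial. -/
def IsTranscendentalEntire (f : ℂ → ℂ) : Prop :=
  Differentiable ℂ f ∧ ¬ ∃ p : Polynomial ℂ, ∀ z, f z = p.eval z

/-- The maximum modulus `M(r, f) = max_{|z| = r} |f z|` (for `r ≥ 0` and continuous `f` the
supremum is attained, see `isGreatest_maxModulus`). -/
noncomputable def maxModulus (f : ℂ → ℂ) (r : ℝ) : ℝ :=
  sSup ((fun z => ‖f z‖) '' Metric.sphere (0 : ℂ) r)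

theorem isGreatest_maxModulus {f : ℂ → ℂ} (hf : Continuous f) {r : ℝ} (hr : 0 ≤ r) :
    IsGreatest ((fun z => ‖f z‖) '' Metric.sphere (0 : ℂ) r) (maxModulus f r) :=
  ((isCompact_sphere (0 : ℂ) r).image hf.norm).isGreatest_sSup
    ((NormedSpace.sphere_nonempty.2 hr).image _)

/-- The standing condition on `R`: `R > 0` and `M(r, f) > r` for all `r ≥ R`. -/
def IsAdmissible (f : ℂ → ℂ) (R : ℝ) : Prop :=
  0 < R ∧ ∀ r, R ≤ r → r < maxModulus f r

/-- The escaping set `I(f) = {z : f^n(z) → ∞}`. -/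
def escapingSet (f : ℂ → ℂ) : Set ℂ :=
  {z | Tendsto (fun n : ℕ => f^[n] z) atTop (Bornology.cobounded ℂ)}

/-- `A_R(f) = {z : |f^n(z)| ≥ M^n(R, f) for all n}`, where `M^n(·, f)` is the `n`-th iterate of
`r ↦ M(r, f)`. -/
def fastEscapingLevel (f : ℂ → ℂ) (R : ℝ) : Set ℂ :=
  {z | ∀ n : ℕ, (maxModulus f)^[n] R ≤ ‖f^[n] z‖}

/-- The fast escaping set `A(f) = {z : ∃ L, |f^(n+L)(z)| ≥ M^n(R, f) for all n}`, formed with the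
radius `R`. -/
def fastEscapingSet (f : ℂ → ℂ) (R : ℝ) : Set ℂ :=
  {z | ∃ L : ℕ, ∀ n : ℕ, (maxModulus f)^[n] R ≤ ‖f^[n + L] z‖}

/-- An (infinite) spider's web: a connected set `E` for which there are bounded simply connected
domains `G 0 ⊆ G 1 ⊆ ⋯` exhausting the plane, with all the boundaries contained in `E`. -/
def IsSpidersWeb (E : Set ℂ) : Prop :=
  IsConnected E ∧ ∃ G : ℕ → Set ℂ,
    (∀ n, IsOpen (G n) ∧ IsSimplyConnected (G n) ∧ Bornology.IsBounded (G n)) ∧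
    (∀ n, G n ⊆ G (n + 1)) ∧
    (∀ n, frontier (G n) ⊆ E) ∧
    ⋃ n, G n = Set.univ

/-- `S` has a bounded connected component. -/
def HasBoundedComponent (S : Set ℂ) : Prop :=
  ∃ z ∈ S, Bornology.IsBounded (connectedComponentIn S z)

end FastEscaping

/-! Write ρ_n = M^n(R, f). By the maximum principle, an orbit that falls behind (ρ_n) stays behind,
so A_R(f) is a decreasing intersection of sets {|f^n| ≥ ρ_n}. The maximum principle also joins each
point of such an intersection, inside it, to the boundary of any bounded neighbourhood
(`exists_isPreconnected_meets_frontier`). Hence the complement of A_R(f) has no holes.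

Let G₀ be a bounded component of that complement. For large n, f^n(G₀) meets the disc |w| < ρ_n, and
its boundary lies in f^n(∂G₀), hence in A_{ρ_n}(f). So the component of 0 in the complement of
A_{ρ_n}(f) lies in f^n(G₀) and is bounded (`exists_isBounded_component`). These components contain
the discs of radius ρ_n and exhaust the plane. Having no holes, they are simply connected
(`HasNoHoles.isSimplyConnected`, by a lattice argument) and have connected boundaries
(`HasNoHoles.isPreconnected_frontier`, by unicoherence).

Any two points of A_R(f) are joined inside it to the boundary of one large domain, so A_R(f) is
connected. The same works for A(f), a union of preimages of A_R(f). A point of I(f) outside A(f)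
lies in a decreasing intersection of continua that meet A(f). The intersection stays in I(f), so the
point cannot be separated from A(f) (`isPreconnected_escapingSet`). -/

namespace FastEscaping

/-! ### Connectedness, components and boundaries. -/

section Topology

variable {X : Type*} [TopologicalSpace X]

theorem subset_of_disjoint_frontier {s t : Set X} (ht : IsPreconnected t)
    (hne : (t ∩ s).Nonempty) (hd : Disjoint t (frontier s)) : t ⊆ s := by
  have hcov : t ⊆ interior s ∪ (closure s)ᶜ := fun x hx => by
    by_contra h
    simp only [Set.mem_union, Set.mem_compl_iff, not_or, not_not] at h
    exact Set.disjoint_left.1 hd hx ⟨h.2, h.1⟩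
  obtain ⟨x, hxt, hxs⟩ := hne
  have hx : x ∈ interior s := (hcov hxt).resolve_right fun h => h (subset_closure hxs)
  exact (ht.subset_left_of_subset_union isOpen_interior isClosed_closure.isOpen_compl
    (Set.disjoint_compl_right_iff_subset.2 (interior_subset.trans subset_closure)) hcov
    ⟨x, hxt, hx⟩).trans interior_subset

/-- Disjoint open neighbourhoods of the two pieces of a separation already contain some `K n`, by
compactness, and `K n` must lie in one of them. -/
theorem isPreconnected_iInter_of_antitone [T2Space X] {K : ℕ → Set X} (hK : Antitone K)
    (hc : ∀ n, IsCompact (K n)) (hp : ∀ n, IsPreconnected (K n)) :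
    IsPreconnected (⋂ n, K n) := by
  have hcl : IsClosed (⋂ n, K n) := isClosed_iInter fun n => (hc n).isClosed
  have hcomp : IsCompact (⋂ n, K n) := (hc 0).of_isClosed_subset hcl (Set.iInter_subset _ 0)
  rw [isPreconnected_iff_subset_of_fully_disjoint_closed hcl]
  intro u v hu hv huv hd
  obtain ⟨U, V, hU, hV, huU, hvV, hUV⟩ := SeparatedNhds.of_isCompact_isCompact
    (hcomp.inter_right hu) (hcomp.inter_right hv)
    (hd.mono Set.inter_subset_right Set.inter_subset_right)
  have hsub : ⋂ n, K n ⊆ U ∪ V := fun x hx =>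
    (huv hx).imp (fun h => huU ⟨hx, h⟩) (fun h => hvV ⟨hx, h⟩)
  obtain ⟨n, hn⟩ := exists_subset_nhds_of_isCompact hK.directed_ge hc
    (fun x hx => (hU.union hV).mem_nhds (hsub hx))
  rcases Set.eq_empty_or_nonempty (⋂ n, K n) with he | ⟨x, hx⟩
  · left; rw [he]; exact Set.empty_subset _
  have key : ∀ {U V u v : Set X}, IsOpen U → IsOpen V → Disjoint U V → K n ⊆ U ∪ V →
      (⋂ n, K n) ⊆ u ∪ v → (⋂ n, K n) ∩ v ⊆ V → x ∈ U → (⋂ n, K n) ⊆ u := by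
    intro U V u v hU hV hUV hn huv hvV hxU y hy
    refine (huv hy).resolve_right fun hyv => ?_
    have := (hp n).subset_left_of_subset_union hU hV hUV hn ⟨x, Set.mem_iInter.1 hx n, hxU⟩
    exact Set.disjoint_left.1 hUV (this (Set.mem_iInter.1 hy n)) (hvV ⟨hy, hyv⟩)
  rcases hsub hx with h | h
  · exact Or.inl (key hU hV hUV hn huv hvV h)
  · exact Or.inr (key hV hU hUV.symm (by rwa [Set.union_comm]) (by rwa [Set.union_comm]) huU h)

/-- Components of `O` are open, so the component of a frontier point lying in `O` would meet, hence
equal, the given one. -/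
theorem frontier_connectedComponentIn_subset [LocallyConnectedSpace X] {O : Set X}
    (hO : IsOpen O) (x : X) : frontier (connectedComponentIn O x) ⊆ Oᶜ := by
  intro y hy hyO
  have hyc : y ∈ closure (connectedComponentIn O x) := hy.1
  have hop := hO.connectedComponentIn (x := y)
  obtain ⟨w, hw1, hw2⟩ := mem_closure_iff.1 hyc _ hop (mem_connectedComponentIn hyO)
  have h1 := connectedComponentIn_eq hw1
  have h2 := connectedComponentIn_eq hw2
  have : y ∈ connectedComponentIn O x := by
    rw [h2, ← h1]; exact mem_connectedComponentIn hyO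
  exact hy.2 ((hO.connectedComponentIn (x := x)).interior_eq.symm ▸ this)

/-- A component of a compact set that lies in an open set has a neighbourhood whose boundary
avoids the compact set. -/
theorem exists_isOpen_frontier_disjoint [T2Space X] [LocallyCompactSpace X] [RegularSpace X]
    {F U : Set X} (hF : IsCompact F) (hU : IsOpen U) {x : X} (hx : x ∈ F)
    (h : connectedComponentIn F x ⊆ U) :
    ∃ V, IsOpen V ∧ x ∈ V ∧ closure V ⊆ U ∧ Disjoint (frontier V) F := by
  have : CompactSpace F := isCompact_iff_compactSpace.1 hF
  have hci := connectedComponent_eq_iInter_isClopen (⟨x, hx⟩ : F)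
  have hUF : IsOpen ((↑) ⁻¹' U : Set F) := hU.preimage continuous_subtype_val
  have hsub : connectedComponent (⟨x, hx⟩ : F) ⊆ (↑) ⁻¹' U := by
    intro y hy
    apply h
    rw [connectedComponentIn_eq_image hx]
    exact ⟨y, hy, rfl⟩
  rw [hci] at hsub
  have : Nonempty { s : Set F // IsClopen s ∧ (⟨x, hx⟩ : F) ∈ s } :=
    ⟨⟨Set.univ, isClopen_univ, Set.mem_univ _⟩⟩
  -- In the compact space `F` the component is the intersection of its clopen neighbourhoods, so one
  -- of them, `Q`, already lies in `U`.
  obtain ⟨Q, hQ⟩ := exists_subset_nhds_of_isCompact'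
    (V := fun s : { s : Set F // IsClopen s ∧ (⟨x, hx⟩ : F) ∈ s } => s.1)
    (by
      intro s t
      exact ⟨⟨s.1 ∩ t.1, s.2.1.inter t.2.1, s.2.2, t.2.2⟩, Set.inter_subset_left,
        Set.inter_subset_right⟩)
    (fun s => s.2.1.isClosed.isCompact) (fun s => s.2.1.isClosed)
    (fun y hy => hUF.mem_nhds (hsub hy))
  have hQ1 : IsCompact ((↑) '' Q.1 : Set X) := Q.2.1.isClosed.isCompact.image continuous_subtype_val
  have hQ2 : IsCompact ((↑) '' Q.1ᶜ : Set X) :=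
    Q.2.1.compl.isClosed.isCompact.image continuous_subtype_val
  have hQU : ((↑) '' Q.1 : Set X) ⊆ U ∩ ((↑) '' Q.1ᶜ : Set X)ᶜ := by
    rintro _ ⟨y, hy, rfl⟩
    refine ⟨hQ hy, ?_⟩
    rintro ⟨z, hz, hzy⟩
    exact hz (Subtype.ext hzy ▸ hy)
  -- `V` contains `Q` and its closure misses the rest of `F`, so no point of `F` is on its boundary.
  obtain ⟨V, hV, hQV, hVU, -⟩ := exists_open_between_and_isCompact_closure hQ1
    (hU.inter hQ2.isClosed.isOpen_compl) hQU
  refine ⟨V, hV, hQV ⟨⟨x, hx⟩, Q.2.2, rfl⟩, hVU.trans Set.inter_subset_left, ?_⟩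
  rw [Set.disjoint_left]
  intro y hy hyF
  by_cases hyQ : (⟨y, hyF⟩ : F) ∈ Q.1
  · exact hy.2 (hV.interior_eq.symm ▸ hQV ⟨_, hyQ, rfl⟩)
  · exact (hVU hy.1).2 ⟨_, hyQ, rfl⟩

end Topology

/-- The continuum principle behind "all components are unbounded": if the sets
`{ρ n ≤ ‖g n‖}` decrease, every point of their intersection is joined to the boundary of every
bounded neighbourhood by a connected subset of the intersection. -/
theorem exists_isPreconnected_meets_frontier {g : ℕ → ℂ → ℂ} (hg : ∀ n, Differentiable ℂ (g n))
    {ρ : ℕ → ℝ} (hanti : ∀ n w, ρ (n + 1) ≤ ‖g (n + 1) w‖ → ρ n ≤ ‖g n w‖)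
    {z : ℂ} (hz : ∀ n, ρ n ≤ ‖g n z‖) {U : Set ℂ} (hU : IsOpen U)
    (hb : Bornology.IsBounded U) (hzU : z ∈ U) :
    ∃ C : Set ℂ, IsPreconnected C ∧ z ∈ C ∧ C ⊆ {w | ∀ n, ρ n ≤ ‖g n w‖} ∧
      (C ∩ frontier U).Nonempty := by
  set F : ℕ → Set ℂ := fun n => closure U ∩ {w | ρ n ≤ ‖g n w‖} with hFdef
  have hFc : ∀ n, IsCompact (F n) := fun n =>
    hb.isCompact_closure.inter_right (isClosed_le continuous_const (hg n).continuous.norm)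
  have hFanti : Antitone F := antitone_nat_of_succ_le fun n w hw => ⟨hw.1, hanti n w hw.2⟩
  have hzF : ∀ n, z ∈ F n := fun n => ⟨subset_closure hzU, hz n⟩
  set C : ℕ → Set ℂ := fun n => connectedComponentIn (F n) z with hCdef
  have hCc : ∀ n, IsCompact (C n) := fun n => by
    have : CompactSpace (F n) := isCompact_iff_compactSpace.1 (hFc n)
    simp only [hCdef, connectedComponentIn_eq_image (hzF n)]
    exact isClosed_connectedComponent.isCompact.image continuous_subtype_val
  have hCanti : Antitone C := fun m n hmn => connectedComponentIn_mono z (hFanti hmn)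
  -- A component staying inside `U` would have a neighbourhood `V` with `‖g n‖ < ρ n` on its
  -- boundary, and the maximum principle would give `‖g n z‖ < ρ n`.
  have hmeet : ∀ n, (C n ∩ frontier U).Nonempty := fun n => by
    by_contra hne
    have hCU : C n ⊆ U := fun w hw => by
      by_contra hwU
      exact hne ⟨w, hw, (connectedComponentIn_subset _ _ hw).1, by rwa [hU.interior_eq]⟩
    obtain ⟨V, hV, hzV, hVU, hdis⟩ := exists_isOpen_frontier_disjoint (hFc n) hU (hzF n) hCU
    have hVb : Bornology.IsBounded V := hb.subset (subset_closure.trans hVU)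
    have hlt : ∀ w ∈ frontier V, ‖g n w‖ < ρ n := fun w hw => by
      by_contra hge
      exact Set.disjoint_left.1 hdis hw ⟨subset_closure (hVU hw.1), not_lt.1 hge⟩
    obtain ⟨c, hc, hcw⟩ : ∃ c < ρ n, ∀ w ∈ frontier V, ‖g n w‖ ≤ c := by
      rcases Set.eq_empty_or_nonempty (frontier V) with he | hne'
      · exact ⟨ρ n - 1, by linarith, by simp [he]⟩
      · obtain ⟨w, hw, hmax⟩ := (hVb.isCompact_closure.of_isClosed_subset isClosed_frontier
          frontier_subset_closure).exists_isMaxOn hne' (hg n).continuous.norm.continuousOn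
        exact ⟨_, hlt w hw, fun y hy => hmax hy⟩
    have := Complex.norm_le_of_forall_mem_frontier_norm_le hVb (hg n).diffContOnCl hcw
      (subset_closure hzV)
    linarith [hz n]
  refine ⟨⋂ n, C n, isPreconnected_iInter_of_antitone hCanti hCc
    fun n => isPreconnected_connectedComponentIn, Set.mem_iInter.2 fun n =>
    mem_connectedComponentIn (hzF n), fun w hw n =>
    (connectedComponentIn_subset _ _ (Set.mem_iInter.1 hw n)).2, ?_⟩
  rw [Set.iInter_inter]
  exact IsCompact.nonempty_iInter_of_sequence_nonempty_isCompact_isClosed _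
    (fun n => Set.inter_subset_inter_left _ (hCanti n.le_succ)) hmeet
    ((hCc 0).inter_right isClosed_frontier) (fun n => (hCc n).isClosed.inter isClosed_frontier)

/-! ### Open sets without holes; unicoherence of the plane. -/

/-- `G` has no holes: a bounded open set with boundary in `G` lies in `G`. -/
def HasNoHoles (G : Set ℂ) : Prop :=
  ∀ U : Set ℂ, IsOpen U → Bornology.IsBounded U → frontier U ⊆ G → U ⊆ G

theorem frontier_nonempty_of_isBounded {U : Set ℂ} (hb : Bornology.IsBounded U)
    (hne : U.Nonempty) : (frontier U).Nonempty :=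
  nonempty_frontier_iff.2 ⟨hne, fun h => NormedSpace.unbounded_univ ℝ ℂ (h ▸ hb)⟩

/-- A point of `U` in another component of `O` would have its whole component inside `U`. The
boundary of that component would then lie in `closure U ⊆ O`, which is impossible. -/
theorem HasNoHoles.of_connectedComponentIn {O : Set ℂ} (hO : IsOpen O) (h : HasNoHoles O) (x : ℂ) :
    HasNoHoles (connectedComponentIn O x) := by
  intro U hU hb hfr p hp
  have hUO : U ⊆ O := h U hU hb (hfr.trans (connectedComponentIn_subset _ _))
  by_contra hpx
  have hdis : Disjoint (connectedComponentIn O p) (frontier U) := by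
    rw [Set.disjoint_left]
    intro y hy hyU
    apply hpx
    rw [connectedComponentIn_eq (hfr hyU), ← connectedComponentIn_eq hy]
    exact mem_connectedComponentIn (hUO hp)
  have hsub : connectedComponentIn O p ⊆ U := subset_of_disjoint_frontier
    isPreconnected_connectedComponentIn ⟨p, mem_connectedComponentIn (hUO hp), hp⟩ hdis
  obtain ⟨y, hy⟩ := frontier_nonempty_of_isBounded (hb.subset hsub)
    ⟨p, mem_connectedComponentIn (hUO hp)⟩
  refine frontier_connectedComponentIn_subset hO p hy ?_
  have : y ∈ closure U := closure_mono hsub hy.1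
  rw [closure_eq_self_union_frontier] at this
  exact this.elim (fun h => hUO h) (fun h => connectedComponentIn_subset _ _ (hfr h))

theorem isPreconnected_setOf_lt_norm {r : ℝ} (hr : 0 < r) : IsPreconnected {z : ℂ | r < ‖z‖} := by
  have himg : {z : ℂ | r < ‖z‖} = Complex.exp '' {w : ℂ | Real.log r < w.re} := by
    ext z
    constructor
    · intro hz
      have hz0 : z ≠ 0 := norm_pos_iff.1 (hr.trans hz)
      refine ⟨Complex.log z, ?_, Complex.exp_log hz0⟩
      rw [Set.mem_ofPred_eq, Complex.log_re]
      exact Real.log_lt_log hr hz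
    · rintro ⟨w, hw, rfl⟩
      rw [Set.mem_ofPred_eq, Complex.norm_exp]
      exact (Real.log_lt_iff_lt_exp hr).1 hw
  rw [himg]
  exact (convex_halfSpace_re_gt _).isPreconnected.image _ Complex.continuous_exp.continuousOn

/-- In a separation of the complement, one piece contains the exterior of a disc. The other then has
a bounded neighbourhood with boundary in `G`, that is, it fills a hole of `G`. -/
theorem HasNoHoles.isPreconnected_compl {G : Set ℂ} (h : HasNoHoles G) (hG : IsOpen G)
    (hb : Bornology.IsBounded G) : IsPreconnected Gᶜ := by
  obtain ⟨r, hr0, hr⟩ := hb.subset_closedBall_lt 0 0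
  have hext : {z : ℂ | r < ‖z‖} ⊆ Gᶜ := fun z hz hzG => by
    have := hr hzG
    simp only [mem_closedBall_zero_iff] at this
    exact absurd hz (not_lt.2 this)
  have key : ∀ u v : Set ℂ, IsClosed u → IsClosed v → Gᶜ ⊆ u ∪ v → Disjoint u v →
      {z : ℂ | r < ‖z‖} ⊆ u → Gᶜ ⊆ u := by
    intro u v hu hv huv hd hru z hz
    refine (huv hz).resolve_right fun hzv => ?_
    obtain ⟨U, hU, hvU, hUu⟩ := normal_exists_closure_subset hv hu.isOpen_compl
      (Set.disjoint_left.1 hd.symm)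
    have hUb : Bornology.IsBounded U := Metric.isBounded_closedBall.subset (t := Metric.closedBall (0 : ℂ) r)
      fun y hy => by
        rw [mem_closedBall_zero_iff]
        by_contra hlt
        exact hUu (subset_closure hy) (hru (not_le.1 hlt))
    refine hz (h U hU hUb (fun y hy => ?_) (hvU hzv))
    by_contra hyG
    rcases huv hyG with hyu | hyv
    · exact hUu hy.1 hyu
    · exact hy.2 (hU.interior_eq.symm ▸ hvU hyv)
  rw [isPreconnected_iff_subset_of_fully_disjoint_closed hG.isClosed_compl]
  intro u v hu hv huv hd
  rcases (isPreconnected_iff_subset_of_disjoint_closed.1 (isPreconnected_setOf_lt_norm hr0)) u v hu hv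
    (hext.trans huv) (by rw [hd.inter_eq, Set.inter_empty]) with h1 | h1
  · exact Or.inl (key u v hu hv huv hd h1)
  · exact Or.inr (key v u hv hu (by rwa [Set.union_comm]) hd.symm h1)

/-- Unicoherence of the plane. -/
theorem isPreconnected_inter_of_union_eq_univ {A B : Set ℂ} (hA : IsClosed A) (hB : IsClosed B)
    (hAc : IsPreconnected A) (hBc : IsPreconnected B) (hAB : A ∪ B = Set.univ) :
    IsPreconnected (A ∩ B) := by
  rw [isPreconnected_iff_subset_of_fully_disjoint_closed (hA.inter hB)]
  intro u v hu hv huv hd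
  by_contra hcon
  rw [not_or, Set.not_subset, Set.not_subset] at hcon
  obtain ⟨⟨q, hqAB, hqu⟩, ⟨p, hpAB, hpv⟩⟩ := hcon
  have hpu : p ∈ u := (huv hpAB).resolve_right hpv
  have hqv : q ∈ v := (huv hqAB).resolve_left hqu
  obtain ⟨φ, hφu, hφv, -⟩ := exists_continuous_zero_one_of_isClosed hu hv hd
  have h2π : (0 : ℝ) < 2 * Real.pi := Real.two_pi_pos
  -- `φ` is 0 on `u` and 1 on `v`, so the two formulas agree on `A ∩ B`. A lift `θ` of `h` is
  -- constant on `B`, and `θ - 2πφ` is constant on `A`; comparing `p` with `q` gives `2π = 0`.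
  set h : ℂ → Circle := fun z => by
    classical exact if z ∈ A then Circle.exp (2 * Real.pi * φ z) else 1 with hh
  have hhA : Set.EqOn h (fun z => Circle.exp (2 * Real.pi * φ z)) A := fun z hz => if_pos hz
  have hhB : Set.EqOn h (fun _ => 1) B := fun z hz => by
    by_cases hzA : z ∈ A
    · rw [hhA hzA]
      rcases huv ⟨hzA, hz⟩ with h1 | h1
      · simp [hφu h1]
      · simp [hφv h1]
    · exact if_neg hzA
  have hcont : Continuous h := by
    rw [← continuousOn_univ, ← hAB]
    refine ContinuousOn.union_of_isClosed ?_ ?_ hA hB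
    · exact ContinuousOn.congr (by fun_prop) hhA
    · exact continuousOn_const.congr hhB
  obtain ⟨θ₀, hθ₀⟩ := Circle.exp_surjective (h p)
  obtain ⟨θ, ⟨-, hθ⟩, -⟩ := Circle.isCoveringMap_exp.existsUnique_continuousMap_lifts
    ⟨h, hcont⟩ p θ₀ hθ₀
  have hθz : ∀ z, Circle.exp (θ z) = h z := fun z => congrFun hθ z
  have hconst : ∀ {S : Set ℂ} {ψ : ℂ → ℝ}, IsPreconnected S → Continuous ψ →
      (∀ z ∈ S, Circle.exp (ψ z) = 1) → ∀ z ∈ S, ∀ w ∈ S, ψ z = ψ w := by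
    intro S ψ hS hψ hψ1 z hz w hw
    have hdisc : DiscreteTopology (AddSubgroup.zmultiples (2 * Real.pi)) := inferInstance
    refine hS.constant_of_mapsTo (T := (AddSubgroup.zmultiples (2 * Real.pi) : Set ℝ))
      ⟨hdisc⟩ hψ.continuousOn (fun y hy => ?_) hz hw
    obtain ⟨n, hn⟩ := Circle.exp_eq_one.1 (hψ1 y hy)
    exact ⟨n, by simp [hn]⟩
  have h1 := hconst hBc θ.continuous (fun z hz => (hθz z).trans (hhB hz)) p hpAB.2 q hqAB.2
  have h2 := hconst (ψ := fun z => θ z - 2 * Real.pi * φ z) hAc (by fun_prop)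
    (fun z hz => by rw [Circle.exp_sub, hθz, hhA hz, div_self']) p hpAB.1 q hqAB.1
  simp only [hφu hpu, hφv hqv, Pi.zero_apply, Pi.one_apply] at h2
  linarith

theorem HasNoHoles.isPreconnected_frontier {G : Set ℂ} (h : HasNoHoles G) (hG : IsOpen G)
    (hb : Bornology.IsBounded G) (hc : IsPreconnected G) : IsPreconnected (frontier G) := by
  rw [frontier, hG.interior_eq, Set.sdiff_eq]
  exact isPreconnected_inter_of_union_eq_univ isClosed_closure hG.isClosed_compl hc.closure
    (h.isPreconnected_compl hG hb)
    (Set.eq_univ_of_forall fun z => (em (z ∈ G)).imp (fun h => subset_closure h) id)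

/-! ### Closed walks in the square lattice. -/

section Lattice

/-- The consecutive pairs of the walk through the vertices of the list, ending at `b`. -/
def walkSteps {V : Type*} : List V → V → List (V × V)
  | [], _ => []
  | a :: l, b => (a, l.headD b) :: walkSteps l b

theorem walkSteps_append {V : Type*} (l₁ : List V) (c : V) (l₂ : List V) (b : V) :
    walkSteps (l₁ ++ c :: l₂) b = walkSteps l₁ c ++ walkSteps (c :: l₂) b := by
  induction l₁ with
  | nil => rfl
  | cons a l ih =>
    rw [List.cons_append, walkSteps, ih]
    cases l <;> rfl

theorem mem_of_mem_walkSteps {V : Type*} {l : List V} {b : V} {s : V × V}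
    (h : s ∈ walkSteps l b) : s.1 ∈ l ∧ (s.2 ∈ l ∨ s.2 = b) := by
  induction l with
  | nil => simp [walkSteps] at h
  | cons a l ih =>
    rw [walkSteps, List.mem_cons] at h
    rcases h with rfl | h
    · refine ⟨by simp, ?_⟩
      cases l <;> simp
    · obtain ⟨h1, h2⟩ := ih h
      exact ⟨List.mem_cons_of_mem _ h1, h2.imp (List.mem_cons_of_mem _) id⟩

/-- The product of the values of `e` along a walk. -/
def walkProd {V Γ : Type*} [Monoid Γ] (e : V → V → Γ) (l : List V) (b : V) : Γ :=
  ((walkSteps l b).map fun s => e s.1 s.2).prod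

theorem walkProd_append {V Γ : Type*} [Monoid Γ] (e : V → V → Γ) (l₁ : List V) (c : V)
    (l₂ : List V) (b : V) :
    walkProd e (l₁ ++ c :: l₂) b = walkProd e l₁ c * walkProd e (c :: l₂) b := by
  simp [walkProd, walkSteps_append]

theorem walkProd_cons {V Γ : Type*} [Monoid Γ] (e : V → V → Γ) (a : V) (l : List V) (b : V) :
    walkProd e (a :: l) b = e a (l.headD b) * walkProd e l b := by
  simp [walkProd, walkSteps]

theorem sum_walkSteps_add {V : Type*} (φ : V → ZMod 2) (a : V) (l : List V) (b : V) :
    ((walkSteps (a :: l) b).map fun s => φ s.1 + φ s.2).sum = φ a + φ b := by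
  induction l generalizing a with
  | nil => simp [walkSteps]
  | cons c l ih =>
    have h2 : φ c + φ c = 0 := CharTwo.add_self_eq_zero _
    rw [walkSteps, List.map_cons, List.sum_cons, ih]
    simp only [List.headD_cons]
    linear_combination h2

/-- Adjacency in the square lattice. -/
def LatticeAdj (a b : ℤ × ℤ) : Prop :=
  (a.1 = b.1 ∧ (b.2 = a.2 + 1 ∨ a.2 = b.2 + 1)) ∨ (a.2 = b.2 ∧ (b.1 = a.1 + 1 ∨ a.1 = b.1 + 1))

/-- A family `A` of lattice edges and a family `S` of unit cells (indexed by their lower left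
corners) in a bounded part of the lattice, such that the cells enclosed by edges of `A`
belong to `S`. -/
structure FilledLattice (A : ℤ × ℤ → ℤ × ℤ → Prop) (S : ℤ × ℤ → Prop) (N : ℤ) : Prop where
  adj : ∀ {a b}, A a b → LatticeAdj a b
  symm : ∀ {a b}, A a b → A b a
  bound : ∀ {a b}, A a b → |a.1| ≤ N ∧ |a.2| ≤ N
  bottom : ∀ {i j}, S (i, j) → A (i, j) (i + 1, j)
  left : ∀ {i j}, S (i, j) → A (i, j) (i, j + 1)
  fill : ∀ T : Set (ℤ × ℤ), T.Finite →
    (∀ i j, ¬ ((i - 1, j) ∈ T ↔ (i, j) ∈ T) → A (i, j) (i, j + 1)) →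
    (∀ i j, ¬ ((i, j - 1) ∈ T ↔ (i, j) ∈ T) → A (i, j) (i + 1, j)) → ∀ c ∈ T, S c

/-- The parity contribution of a step to the cell `(i, j)`: vertical steps to its right count. -/
def cellParity (i j : ℤ) (s : (ℤ × ℤ) × (ℤ × ℤ)) : ZMod 2 :=
  if s.1.1 = s.2.1 ∧ i < s.1.1 ∧ min s.1.2 s.2.2 = j then 1 else 0

variable {A : ℤ × ℤ → ℤ × ℤ → Prop} {S : ℤ × ℤ → Prop} {N : ℤ}

/-- The two cells share the edge from `(i, j)` to `(i, j + 1)`, and only steps along that edge are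
counted for one cell and not for the other. -/
theorem cellParity_sum_eq_left (h : FilledLattice A S N) {l : List (ℤ × ℤ)} {b : ℤ × ℤ}
    (hl : ∀ s ∈ walkSteps l b, A s.1 s.2) {i j : ℤ} (hA : ¬ A (i, j) (i, j + 1)) :
    ((walkSteps l b).map (cellParity (i - 1) j)).sum =
      ((walkSteps l b).map (cellParity i j)).sum := by
  congr 1
  refine List.map_congr_left fun s hs => ?_
  obtain ⟨⟨x, y⟩, ⟨x', y'⟩⟩ := s
  have hs' := hl _ hs
  have hadj := h.adj hs'
  have h1 : ¬ (x = i ∧ y = j ∧ x' = i ∧ y' = j + 1) := by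
    rintro ⟨rfl, rfl, rfl, rfl⟩; exact hA hs'
  have h2 : ¬ (x' = i ∧ y' = j ∧ x = i ∧ y = j + 1) := by
    rintro ⟨rfl, rfl, rfl, rfl⟩; exact hA (h.symm hs')
  simp only [LatticeAdj] at hadj
  simp only [cellParity]
  congr 1
  rw [eq_iff_iff]
  omega

/-- Off the shared edge, the two counts of a step differ by the coboundary of the indicator of the
half-line `x > i, y = j`, which telescopes to zero on a closed walk. -/
theorem cellParity_sum_eq_below (h : FilledLattice A S N) {v : ℤ × ℤ} {l : List (ℤ × ℤ)}
    (hl : ∀ s ∈ walkSteps (v :: l) v, A s.1 s.2) {i j : ℤ} (hA : ¬ A (i, j) (i + 1, j)) :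
    ((walkSteps (v :: l) v).map (cellParity i (j - 1))).sum =
      ((walkSteps (v :: l) v).map (cellParity i j)).sum := by
  set φ : ℤ × ℤ → ZMod 2 := fun p => if i < p.1 ∧ p.2 = j then 1 else 0 with hφ
  have hstep : ∀ s ∈ walkSteps (v :: l) v,
      cellParity i (j - 1) s = cellParity i j s + (φ s.1 + φ s.2) := by
    rintro ⟨⟨x, y⟩, ⟨x', y'⟩⟩ hs
    have hs' := hl _ hs
    have hadj := h.adj hs'
    have h1 : ¬ (x = i ∧ y = j ∧ x' = i + 1 ∧ y' = j) := by
      rintro ⟨rfl, rfl, rfl, rfl⟩; exact hA hs'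
    have h2 : ¬ (x' = i ∧ y' = j ∧ x = i + 1 ∧ y = j) := by
      rintro ⟨rfl, rfl, rfl, rfl⟩; exact hA (h.symm hs')
    simp only [LatticeAdj] at hadj
    simp only [cellParity, hφ]
    have h11 : (1 : ZMod 2) + 1 = 0 := by decide
    split_ifs <;> first
      | (exfalso; omega)
      | simp [h11]
  rw [List.map_congr_left hstep, List.sum_map_add, sum_walkSteps_add,
    CharTwo.add_self_eq_zero, add_zero]

/-- The cells of odd parity with respect to a closed walk belong to `S`. -/
theorem cell_of_cellParity_sum (h : FilledLattice A S N) {v : ℤ × ℤ} {l : List (ℤ × ℤ)}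
    (hl : ∀ s ∈ walkSteps (v :: l) v, A s.1 s.2) {i j : ℤ}
    (hij : ((walkSteps (v :: l) v).map (cellParity i j)).sum = 1) : S (i, j) := by
  set σ : ℤ → ℤ → ZMod 2 := fun i j => ((walkSteps (v :: l) v).map (cellParity i j)).sum with hσ
  have hzero : ∀ i j, (N ≤ i ∨ N < j ∨ j < -N) → σ i j = 0 := by
    intro i j hcase
    refine List.sum_eq_zero fun x hx => ?_
    obtain ⟨s, hs, rfl⟩ := List.mem_map.1 hx
    have h1 := h.bound (hl s hs)
    have h2 := h.bound (h.symm (hl s hs))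
    rw [abs_le, abs_le] at h1 h2
    refine if_neg ?_
    omega
  have hleft : ∀ i j, i < -N → σ i j = 0 := by
    intro i j hi
    have hstep : ∀ k : ℕ, σ i j = σ i (j + k) := by
      intro k
      induction k with
      | zero => simp
      | succ k ih =>
        -- So far to the left no horizontal edge is in `A`, hence the parity is constant along the
        -- column and vanishes high up.
        have := cellParity_sum_eq_below h hl (i := i) (j := j + k + 1) (fun hA => by
          have := (h.bound hA).1
          rw [abs_le] at this
          omega)
        have hk : j + (k + 1 : ℕ) = j + k + 1 := by push_cast; ring
        rw [add_sub_cancel_right] at this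
        rw [ih, hk]
        exact this
    rw [hstep (N + 1 - j).toNat]
    exact hzero _ _ (Or.inr (Or.inl (by omega)))
  -- The odd cells form a finite set, and any edge between an odd and an even cell is in `A`.
  refine h.fill {c | σ c.1 c.2 = 1} ?_ ?_ ?_ (i, j) hij
  · refine (Set.finite_Icc ((-N, -N) : ℤ × ℤ) (N, N)).subset ?_
    rintro ⟨a, b⟩ hab
    have hab' : σ a b = 1 := hab
    have h1 : ¬ (N ≤ a ∨ N < b ∨ b < -N) := fun hc => by
      rw [hzero a b hc] at hab'; exact zero_ne_one hab'
    have h2 : ¬ a < -N := fun hc => by rw [hleft a b hc] at hab'; exact zero_ne_one hab'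
    refine ⟨⟨?_, ?_⟩, ⟨?_, ?_⟩⟩ <;> simp only <;> omega
  · intro i j hne
    by_contra hA
    apply hne
    simp only [Set.mem_ofPred_eq, hσ, cellParity_sum_eq_left h hl hA]
  · intro i j hne
    by_contra hA
    apply hne
    simp only [Set.mem_ofPred_eq, hσ, cellParity_sum_eq_below h hl hA]

/-- At a vertex that is maximal for `x + y` and visited only once, a closed walk either backtracks
or turns around a cell of `S`. -/
theorem corner_cell_of_closed_walk (h : FilledLattice A S N) {v u w : ℤ × ℤ} {m : List (ℤ × ℤ)}
    (hl : ∀ s ∈ walkSteps (v :: u :: (m ++ [w])) v, A s.1 s.2)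
    (hmax : ∀ p ∈ u :: (m ++ [w]), p.1 + p.2 ≤ v.1 + v.2)
    (hv : v ∉ u :: (m ++ [w])) (huw : u ≠ w) :
    S (v.1 - 1, v.2 - 1) ∧
      ((u = (v.1 - 1, v.2) ∧ w = (v.1, v.2 - 1)) ∨ (u = (v.1, v.2 - 1) ∧ w = (v.1 - 1, v.2))) := by
  have hsteps : walkSteps (v :: u :: (m ++ [w])) v =
      (v, u) :: (walkSteps (u :: m) w ++ [(w, v)]) := by
    rw [walkSteps, ← List.cons_append, walkSteps_append]
    rfl
  have hvu := h.adj (hl (v, u) (by simp [hsteps]))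
  have hwv := h.adj (hl (w, v) (by simp [hsteps]))
  have hmu := hmax u (by simp)
  have hmw := hmax w (by simp)
  obtain ⟨a, b⟩ := v
  obtain ⟨u1, u2⟩ := u
  obtain ⟨w1, w2⟩ := w
  simp only [LatticeAdj] at hvu hwv
  simp only at hmu hmw
  have hcases : (u1 = a - 1 ∧ u2 = b ∧ w1 = a ∧ w2 = b - 1) ∨
      (u1 = a ∧ u2 = b - 1 ∧ w1 = a - 1 ∧ w2 = b) := by
    have hne : ¬ (u1 = w1 ∧ u2 = w2) := by rintro ⟨rfl, rfl⟩; exact huw rfl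
    omega
  refine ⟨cell_of_cellParity_sum h hl ?_, ?_⟩
  · have hmid : ((walkSteps ((u1, u2) :: m) (w1, w2)).map (cellParity (a - 1) (b - 1))).sum = 0 := by
      refine List.sum_eq_zero fun x hx => ?_
      obtain ⟨⟨⟨p1, p2⟩, ⟨q1, q2⟩⟩, hs, rfl⟩ := List.mem_map.1 hx
      have hadj := h.adj (hl ((p1, p2), (q1, q2)) (by rw [hsteps]; simp [hs]))
      obtain ⟨hp, hq⟩ := mem_of_mem_walkSteps hs
      have hp' : (p1, p2) ∈ (u1, u2) :: (m ++ [(w1, w2)]) := by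
        rw [← List.cons_append]; exact List.mem_append_left _ hp
      have hq' : (q1, q2) ∈ (u1, u2) :: (m ++ [(w1, w2)]) := by
        rw [← List.cons_append, List.mem_append, List.mem_singleton]
        exact hq
      have hpm := hmax _ hp'
      have hqm := hmax _ hq'
      have hpv : ¬ (p1 = a ∧ p2 = b) := by rintro ⟨rfl, rfl⟩; exact hv hp'
      have hqv : ¬ (q1 = a ∧ q2 = b) := by rintro ⟨rfl, rfl⟩; exact hv hq'
      simp only [LatticeAdj] at hadj
      simp only at hpm hqm
      refine if_neg ?_
      simp only
      omega
    rw [hsteps, List.map_cons, List.sum_cons, List.map_append, List.sum_append, hmid]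
    rcases hcases with ⟨rfl, rfl, rfl, rfl⟩ | ⟨rfl, rfl, rfl, rfl⟩ <;>
      (simp [cellParity]; try omega)
  · rcases hcases with ⟨rfl, rfl, rfl, rfl⟩ | ⟨rfl, rfl, rfl, rfl⟩ <;> simp

/-- Closed walks in a filled lattice have trivial holonomy. -/
theorem walkProd_closed_eq_one (h : FilledLattice A S N) {Γ : Type*} [Group Γ]
    (e : ℤ × ℤ → ℤ × ℤ → Γ) (hinv : ∀ a b, A a b → e a b * e b a = 1)
    (hsq : ∀ i j, S (i, j) → e (i, j + 1) (i + 1, j + 1) * e (i + 1, j + 1) (i + 1, j) =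
      e (i, j + 1) (i, j) * e (i, j) (i + 1, j))
    (v : ℤ × ℤ) (l : List (ℤ × ℤ)) (hl : ∀ s ∈ walkSteps (v :: l) v, A s.1 s.2) :
    walkProd e (v :: l) v = 1 := by
  -- Induction on the length, then on this total height. The shift by `2 * N` keeps the summands
  -- nonnegative on the bounded lattice, so that `toNat` loses nothing.
  set μ : List (ℤ × ℤ) → ℕ := fun l => (l.map fun p => (p.1 + p.2 + 2 * N).toNat).sum with hμ
  obtain ⟨n, hn⟩ : ∃ n, l.length = n := ⟨_, rfl⟩
  obtain ⟨k, hk⟩ : ∃ k, μ (v :: l) = k := ⟨_, rfl⟩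
  induction n using Nat.strong_induction_on generalizing v l k with
  | _ n ihn =>
  induction k using Nat.strong_induction_on generalizing v l with
  | _ k ihk =>
  -- reduction to a base point that is maximal for `x + y`
  suffices hmaxcase : ∀ v l, (∀ s ∈ walkSteps (v :: l) v, A s.1 s.2) → l.length = n →
      μ (v :: l) = k → (∀ p ∈ l, p.1 + p.2 ≤ v.1 + v.2) → walkProd e (v :: l) v = 1 by
    obtain ⟨x, hx, hxmax⟩ := (v :: l).toFinset.exists_max_image (fun p => p.1 + p.2) (by simp)
    rw [List.mem_toFinset] at hx
    have hxmax' : ∀ p ∈ v :: l, p.1 + p.2 ≤ x.1 + x.2 :=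
      fun p hp => hxmax p (List.mem_toFinset.2 hp)
    obtain ⟨l₁, l₂, hl₁₂⟩ := List.append_of_mem hx
    cases l₁ with
    | nil =>
      obtain ⟨rfl, rfl⟩ := List.cons.inj hl₁₂
      exact hmaxcase v l hl hn hk fun p hp => hxmax' p (List.mem_cons_of_mem _ hp)
    | cons a l₁ =>
      rw [List.cons_append] at hl₁₂
      obtain ⟨rfl, rfl⟩ := List.cons.inj hl₁₂
      rw [← List.cons_append, walkSteps_append] at hl
      have hrot := hmaxcase x (l₂ ++ v :: l₁) (by
        intro s hs
        rw [← List.cons_append, walkSteps_append, List.mem_append] at hs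
        exact hl s (List.mem_append.2 hs.symm)) (by
        rw [← hn]; simp only [List.length_append, List.length_cons]; omega) (by
        rw [← hk]; simp only [hμ, List.map_append, List.map_cons, List.sum_append, List.sum_cons]
        omega) (by
        intro p hp
        apply hxmax'
        rw [← List.cons_append] at *
        simp only [List.mem_append, List.mem_cons] at hp ⊢
        tauto)
      rw [← List.cons_append, walkProd_append] at hrot ⊢
      exact mul_eq_one_comm.1 hrot
  intro v l hl hn hk hmax
  -- A revisited base point splits the walk into two shorter closed walks.
  by_cases hvl : v ∈ l
  · obtain ⟨l₁, l₂, rfl⟩ := List.append_of_mem hvl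
    rw [← List.cons_append, walkSteps_append] at hl
    rw [← List.cons_append, walkProd_append,
      ihn l₁.length (by rw [← hn]; simp) v l₁
        (fun s hs => hl s (List.mem_append_left _ hs)) rfl _ rfl,
      ihn l₂.length (by rw [← hn]; simp; omega) v l₂
        (fun s hs => hl s (List.mem_append_right _ hs)) rfl _ rfl, one_mul]
  cases l with
  | nil =>
    have := h.adj (hl (v, v) (by simp [walkSteps]))
    simp [LatticeAdj] at this
  | cons u l =>
  rcases List.eq_nil_or_concat' l with rfl | ⟨m, w, rfl⟩
  · have := hinv _ _ (hl (v, u) (by simp [walkSteps]))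
    simpa [walkProd, walkSteps] using this
  have hsteps : walkSteps (v :: u :: (m ++ [w])) v =
      (v, u) :: (walkSteps (u :: m) w ++ [(w, v)]) := by
    rw [walkSteps, ← List.cons_append, walkSteps_append]
    rfl
  have hprod : ∀ x, walkProd e (x :: u :: (m ++ [w])) x = e x u * (walkProd e (u :: m) w * e w x) := by
    intro x
    rw [walkProd_cons, ← List.cons_append, walkProd_append]
    simp [walkProd, walkSteps]
  have hAvu : A v u := hl (v, u) (by simp [hsteps])
  have hAwv : A w v := hl (w, v) (by simp [hsteps])
  have hAmid : ∀ s ∈ walkSteps (u :: m) w, A s.1 s.2 := fun s hs => hl s (by simp [hsteps, hs])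
  rw [hprod]
  by_cases huw : u = w
  · subst huw
    rw [ihn m.length (by rw [← hn]; simp) u m hAmid rfl _ rfl, one_mul]
    exact hinv _ _ hAvu
  obtain ⟨hS, hcorner⟩ := corner_cell_of_closed_walk h hl hmax hvl huw
  -- push the corner `v` across the cell
  set s : ℤ × ℤ := (v.1 - 1, v.2 - 1) with hs
  have hsq' := hsq _ _ hS
  have hb := h.bottom hS
  have hlft := h.left hS
  simp only [sub_add_cancel] at hsq' hb hlft
  have hAs : A s u ∧ A w s := by
    rcases hcorner with ⟨rfl, rfl⟩ | ⟨rfl, rfl⟩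
    · exact ⟨hlft, h.symm hb⟩
    · exact ⟨hb, h.symm hlft⟩
  have hnew := ihk (μ (s :: u :: (m ++ [w]))) (by
      have hN := h.bound hAs.1
      rw [abs_le, abs_le, hs] at hN
      simp only at hN
      rw [← hk]
      simp only [hμ, List.map_cons, List.sum_cons, hs]
      omega) s (u :: (m ++ [w])) (by
      have hsteps' : walkSteps (s :: u :: (m ++ [w])) s =
          (s, u) :: (walkSteps (u :: m) w ++ [(w, s)]) := by
        rw [walkSteps, ← List.cons_append, walkSteps_append]
        rfl
      rw [hsteps']
      intro t ht
      simp only [List.mem_cons, List.mem_append, List.not_mem_nil, or_false] at ht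
      rcases ht with rfl | ht | rfl
      · exact hAs.1
      · exact hAmid t ht
      · exact hAs.2) hn rfl
  rw [hprod] at hnew
  -- The two routes from `w` to `u` around the cell; in one orientation this is the inverse of
  -- `hsq'`.
  have hconj : e w v * e v u = e w s * e s u := by
    have hi1 := hinv _ _ hAvu
    have hi2 := hinv _ _ hAwv
    have hi3 := hinv _ _ hAs.1
    have hi4 := hinv _ _ hAs.2
    rcases hcorner with ⟨rfl, rfl⟩ | ⟨rfl, rfl⟩
    · have := congrArg (fun x => x⁻¹) hsq'
      simp only [mul_inv_rev] at this
      rwa [inv_eq_of_mul_eq_one_left hi2, inv_eq_of_mul_eq_one_left hi1,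
        inv_eq_of_mul_eq_one_left hi4, inv_eq_of_mul_eq_one_left hi3] at this
    · exact hsq'
  rw [mul_eq_one_comm, mul_assoc] at hnew ⊢
  rw [hconj]
  exact hnew

end Lattice

/-! ### The square lattice of mesh ε inside a set without holes. -/

section Cells

open Complex

/-- The points of the square lattice of mesh `ε`. -/
def latticePt (ε : ℝ) (a : ℤ × ℤ) : ℂ := ⟨ε * a.1, ε * a.2⟩

/-- The closed cells of the square lattice of mesh `ε`, indexed by their lower left corners. -/
def latticeCell (ε : ℝ) (c : ℤ × ℤ) : Set ℂ :=
  Set.Icc (ε * c.1) (ε * (c.1 + 1)) ×ℂ Set.Icc (ε * c.2) (ε * (c.2 + 1))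

/-- The lattice point at the lower left corner of a cell containing `z`. -/
noncomputable def latticeFloor (ε : ℝ) (z : ℂ) : ℤ × ℤ := (⌊z.re / ε⌋, ⌊z.im / ε⌋)

variable {ε : ℝ}

theorem mem_latticeCell (hε : 0 < ε) {c : ℤ × ℤ} {z : ℂ} :
    z ∈ latticeCell ε c ↔ ((c.1 : ℝ) ≤ z.re / ε ∧ z.re / ε ≤ c.1 + 1) ∧
      ((c.2 : ℝ) ≤ z.im / ε ∧ z.im / ε ≤ c.2 + 1) := by
  simp only [latticeCell, mem_reProdIm, Set.mem_Icc, le_div_iff₀ hε, div_le_iff₀ hε, mul_comm ε]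

theorem convex_latticeCell (c : ℤ × ℤ) : Convex ℝ (latticeCell ε c) :=
  ((convex_Icc _ _).is_linear_preimage reLm.isLinear).inter
    ((convex_Icc _ _).is_linear_preimage imLm.isLinear)

theorem isCompact_latticeCell (c : ℤ × ℤ) : IsCompact (latticeCell ε c) :=
  isCompact_Icc.reProdIm isCompact_Icc

theorem latticeCell_subset_closure_interior (hε : 0 < ε) (c : ℤ × ℤ) :
    latticeCell ε c ⊆ closure (interior (latticeCell ε c)) := by
  have h : ∀ x : ℝ, ε * x ≠ ε * (x + 1) := fun x => by
    intro h; nlinarith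
  rw [latticeCell, interior_reProdIm, interior_Icc, interior_Icc, closure_reProdIm,
    closure_Ioo (h _), closure_Ioo (h _)]

theorem mem_latticeCell_latticeFloor (hε : 0 < ε) (z : ℂ) :
    z ∈ latticeCell ε (latticeFloor ε z) :=
  (mem_latticeCell hε).2 ⟨⟨Int.floor_le _, (Int.lt_floor_add_one _).le⟩,
    ⟨Int.floor_le _, (Int.lt_floor_add_one _).le⟩⟩

theorem eventually_floor_le (x : ℝ) : ∀ᶠ y in 𝓝 x, (⌊y⌋ : ℝ) ≤ x ∧ x ≤ ⌊y⌋ + 1 := by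
  have h1 : (⌈x⌉ : ℝ) - 1 < x := by linarith [Int.ceil_lt_add_one x]
  filter_upwards [Ioo_mem_nhds h1 (Int.lt_floor_add_one x)] with y hy
  constructor
  · have : ⌊y⌋ < ⌊x⌋ + 1 := Int.floor_lt.2 (by exact_mod_cast hy.2)
    exact Int.le_floor.1 (by omega)
  · have : ⌈x⌉ - 1 ≤ ⌊y⌋ := Int.le_floor.2 (by push_cast; exact hy.1.le)
    have := Int.ceil_le.1 (show ⌈x⌉ ≤ ⌊y⌋ + 1 by omega)
    exact_mod_cast this

/-- Thus the cells containing `p` cover a neighbourhood of `p`. -/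
theorem eventually_mem_latticeCell (hε : 0 < ε) (p : ℂ) :
    ∀ᶠ q in 𝓝 p, p ∈ latticeCell ε (latticeFloor ε q) := by
  have h1 : Tendsto (fun q : ℂ => q.re / ε) (𝓝 p) (𝓝 (p.re / ε)) :=
    (continuous_re.div_const ε).tendsto p
  have h2 : Tendsto (fun q : ℂ => q.im / ε) (𝓝 p) (𝓝 (p.im / ε)) :=
    (continuous_im.div_const ε).tendsto p
  filter_upwards [h1.eventually (eventually_floor_le _), h2.eventually (eventually_floor_le _)]
    with q hq1 hq2
  exact (mem_latticeCell hε).2 ⟨hq1, hq2⟩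

theorem latticePt_mem_latticeCell (hε : 0 < ε) {a c : ℤ × ℤ} (h1 : c.1 ≤ a.1 ∧ a.1 ≤ c.1 + 1)
    (h2 : c.2 ≤ a.2 ∧ a.2 ≤ c.2 + 1) : latticePt ε a ∈ latticeCell ε c := by
  rw [mem_latticeCell hε]
  simp only [latticePt, mul_div_cancel_left₀ _ hε.ne']
  exact ⟨⟨by exact_mod_cast h1.1, by exact_mod_cast h1.2⟩,
    ⟨by exact_mod_cast h2.1, by exact_mod_cast h2.2⟩⟩

theorem mem_segment_vertical (hε : 0 < ε) {i j : ℤ} {p : ℂ} (h1 : p.re / ε = i)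
    (h2 : (j : ℝ) ≤ p.im / ε) (h3 : p.im / ε ≤ j + 1) :
    p ∈ segment ℝ (latticePt ε (i, j)) (latticePt ε (i, j + 1)) := by
  refine ⟨j + 1 - p.im / ε, p.im / ε - j, by linarith, by linarith, by ring, ?_⟩
  have h1' : p.re = ε * i := by rw [← h1]; field_simp
  apply Complex.ext
  · simp [latticePt, h1']; ring
  · simp [latticePt]; field_simp; ring

theorem mem_segment_horizontal (hε : 0 < ε) {i j : ℤ} {p : ℂ} (h1 : p.im / ε = j)
    (h2 : (i : ℝ) ≤ p.re / ε) (h3 : p.re / ε ≤ i + 1) :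
    p ∈ segment ℝ (latticePt ε (i, j)) (latticePt ε (i + 1, j)) := by
  refine ⟨i + 1 - p.re / ε, p.re / ε - i, by linarith, by linarith, by ring, ?_⟩
  have h1' : p.im = ε * j := by rw [← h1]; field_simp
  apply Complex.ext
  · simp [latticePt]; field_simp; ring
  · simp [latticePt, h1']; ring

/-- At a point outside `G`, the cells containing it are all in `T` or all outside, since passing
between them crosses only edges not contained in `G`. So the union of the cells of `T` has interior
with boundary in `G`, and there is no hole for it to fill. -/
theorem HasNoHoles.latticeCell_subset {G : Set ℂ} (h : HasNoHoles G) (hε : 0 < ε)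
    {T : Set (ℤ × ℤ)} (hT : T.Finite)
    (hv : ∀ i j, ¬ ((i - 1, j) ∈ T ↔ (i, j) ∈ T) →
      segment ℝ (latticePt ε (i, j)) (latticePt ε (i, j + 1)) ⊆ G)
    (hh : ∀ i j, ¬ ((i, j - 1) ∈ T ↔ (i, j) ∈ T) →
      segment ℝ (latticePt ε (i, j)) (latticePt ε (i + 1, j)) ⊆ G) {c : ℤ × ℤ} (hc : c ∈ T) :
    latticeCell ε c ⊆ G := by
  set K : Set ℂ := ⋃ c ∈ T, latticeCell ε c with hK
  have hKc : IsCompact K := hT.isCompact_biUnion fun c _ => isCompact_latticeCell c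
  have hfr : frontier (interior K) ⊆ G := by
    intro p hp
    by_contra hpG
    have hpK : p ∈ K := closure_minimal interior_subset hKc.isClosed hp.1
    have hpi : p ∉ interior K := by simpa using hp.2
    have hv' : ∀ i j : ℤ, p ∈ latticeCell ε (i - 1, j) → p ∈ latticeCell ε (i, j) →
        ((i - 1, j) ∈ T ↔ (i, j) ∈ T) := by
      intro i j h1 h2
      by_contra hne
      rw [mem_latticeCell hε] at h1 h2
      push_cast at h1
      exact hpG (hv i j hne (mem_segment_vertical hε
        (le_antisymm (by linarith [h1.1.2]) h2.1.1) h2.2.1 h2.2.2))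
    have hh' : ∀ i j : ℤ, p ∈ latticeCell ε (i, j - 1) → p ∈ latticeCell ε (i, j) →
        ((i, j - 1) ∈ T ↔ (i, j) ∈ T) := by
      intro i j h1 h2
      by_contra hne
      rw [mem_latticeCell hε] at h1 h2
      push_cast at h1
      exact hpG (hh i j hne (mem_segment_horizontal hε
        (le_antisymm (by linarith [h1.2.2]) h2.2.1) h2.1.1 h2.1.2))
    have hclose : ∀ {x : ℝ} {m n : ℤ}, (m : ℝ) ≤ x → x ≤ m + 1 → (n : ℝ) ≤ x → x ≤ n + 1 →
        n = m ∨ n = m - 1 ∨ m = n - 1 := by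
      intro x m n h1 h2 h3 h4
      have h5 : n ≤ m + 1 := by exact_mod_cast h3.trans h2
      have h6 : m ≤ n + 1 := by exact_mod_cast h1.trans h4
      omega
    have hall : ∀ c d : ℤ × ℤ, p ∈ latticeCell ε c → p ∈ latticeCell ε d → c ∈ T → d ∈ T := by
      rintro ⟨i, j⟩ ⟨i', j'⟩ h1 h2 hcT
      have h1' := (mem_latticeCell hε).1 h1
      have h2' := (mem_latticeCell hε).1 h2
      -- Changing one coordinate at a time leads through a cell that still contains `p`.
      have h3 : p ∈ latticeCell ε (i', j) := (mem_latticeCell hε).2 ⟨h2'.1, h1'.2⟩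
      have hT1 : (i', j) ∈ T := by
        rcases hclose h1'.1.1 h1'.1.2 h2'.1.1 h2'.1.2 with rfl | rfl | rfl
        · exact hcT
        · exact (hv' _ _ h3 h1).2 hcT
        · exact (hv' _ _ h1 h3).1 hcT
      rcases hclose h1'.2.1 h1'.2.2 h2'.2.1 h2'.2.2 with rfl | rfl | rfl
      · exact hT1
      · exact (hh' _ _ h2 h3).2 hT1
      · exact (hh' _ _ h3 h2).1 hT1
    obtain ⟨c₀, hc₀T, hc₀⟩ := Set.mem_iUnion₂.1 hpK
    refine hpi (mem_interior_iff_mem_nhds.2 ?_)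
    filter_upwards [eventually_mem_latticeCell hε p] with q hq
    exact Set.mem_iUnion₂.2 ⟨_, hall _ _ hc₀ hq hc₀T, mem_latticeCell_latticeFloor hε q⟩
  have hUG := h _ isOpen_interior (hKc.isBounded.subset interior_subset) hfr
  calc latticeCell ε c ⊆ closure (interior (latticeCell ε c)) :=
        latticeCell_subset_closure_interior hε c
    _ ⊆ closure (interior K) :=
        closure_mono (interior_mono (Set.subset_biUnion_of_mem (u := latticeCell ε) hc))
    _ ⊆ G := by
        rw [closure_eq_self_union_frontier]
        exact Set.union_subset hUG hfr

theorem HasNoHoles.filledLattice {G : Set ℂ} (h : HasNoHoles G)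
    (hb : Bornology.IsBounded G) (hε : 0 < ε) :
    ∃ N, FilledLattice
      (fun a b => LatticeAdj a b ∧ segment ℝ (latticePt ε a) (latticePt ε b) ⊆ G)
      (fun c => latticeCell ε c ⊆ G) N := by
  obtain ⟨r, hr⟩ := hb.subset_closedBall 0
  have hN : ∀ x : ℤ, |ε * x| ≤ r → |x| ≤ ⌈r / ε⌉ := by
    intro x hx
    have : ((|x| : ℤ) : ℝ) ≤ r / ε := by
      rw [le_div_iff₀ hε, Int.cast_abs, mul_comm]
      rwa [abs_mul, abs_of_pos hε] at hx
    exact_mod_cast this.trans (Int.le_ceil _)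
  have hcellseg : ∀ {c a b : ℤ × ℤ}, latticeCell ε c ⊆ G → latticePt ε a ∈ latticeCell ε c →
      latticePt ε b ∈ latticeCell ε c → segment ℝ (latticePt ε a) (latticePt ε b) ⊆ G :=
    fun hc ha hb => ((convex_latticeCell _).segment_subset ha hb).trans hc
  refine ⟨⌈r / ε⌉, fun h => h.1, fun {a b} h => ⟨?_, by rw [segment_symm]; exact h.2⟩, fun {a b} h => ?_,
    fun {i j} hS => ⟨by simp [LatticeAdj], hcellseg hS (latticePt_mem_latticeCell hε ?_ ?_)
      (latticePt_mem_latticeCell hε ?_ ?_)⟩,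
    fun {i j} hS => ⟨by simp [LatticeAdj], hcellseg hS (latticePt_mem_latticeCell hε ?_ ?_)
      (latticePt_mem_latticeCell hε ?_ ?_)⟩,
    fun T hT hv hh c hc => h.latticeCell_subset hε hT (fun i j hij => (hv i j hij).2)
      (fun i j hij => (hh i j hij).2) hc⟩
  · have := h.1
    simp only [LatticeAdj] at this ⊢
    omega
  · have ha := hr (h.2 (left_mem_segment ℝ _ _))
    rw [mem_closedBall_zero_iff] at ha
    exact ⟨hN _ ((abs_re_le_norm _).trans ha), hN _ ((abs_im_le_norm _).trans ha)⟩
  all_goals simp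

end Cells

/-! ### Holonomy of paths and of segments. -/

section Holonomy

/-- The fundamental group, as a target for all paths of a path connected space. -/
theorem exists_path_holonomy (Y : Type) [TopologicalSpace Y] [PathConnectedSpace Y] (x₀ : Y) :
    ∃ (Γ : Type) (_ : Group Γ) (Φ : ∀ {a b : Y}, Path a b → Γ),
      (∀ {a b : Y} (p q : Path a b), p.Homotopic q → Φ p = Φ q) ∧
      (∀ {a b c : Y} (p : Path a b) (q : Path b c), Φ (p.trans q) = Φ p * Φ q) ∧
      ∀ p : Path x₀ x₀, Φ p = 1 → p.Homotopic (Path.refl x₀) := by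
  -- Fixed paths `s y` from the base point turn every path into a loop at `x₀`.
  let s : ∀ y : Y, Path.Homotopic.Quotient x₀ y :=
    fun y => Path.Homotopic.Quotient.mk (PathConnectedSpace.somePath x₀ y)
  let c : ∀ {a b : Y}, Path.Homotopic.Quotient a b → Path.Homotopic.Quotient x₀ x₀ :=
    fun {a b} p => ((s a).trans p).trans (s b).symm
  have hmul : ∀ {a b d : Y} (p : Path.Homotopic.Quotient a b) (q : Path.Homotopic.Quotient b d),
      c (p.trans q) = (c p).trans (c q) := by
    intro a b d p q
    have h := Path.Homotopic.Quotient.symm_trans (s b)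
    simp only [c, Path.Homotopic.Quotient.trans_assoc]
    rw [← Path.Homotopic.Quotient.trans_assoc (s b).symm, h, Path.Homotopic.Quotient.refl_trans]
  have hone : ∀ p : Path.Homotopic.Quotient x₀ x₀, c p = .refl x₀ → p = .refl x₀ := by
    intro p hp
    have h2 := congrArg (fun x => ((s x₀).symm.trans x).trans (s x₀)) hp
    simp only [c, Path.Homotopic.Quotient.trans_assoc, Path.Homotopic.Quotient.symm_trans,
      Path.Homotopic.Quotient.trans_refl] at h2
    rwa [← Path.Homotopic.Quotient.trans_assoc, Path.Homotopic.Quotient.symm_trans,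
      Path.Homotopic.Quotient.refl_trans] at h2
  -- The opposite group is needed because multiplication in `FundamentalGroup` reverses the order of
  -- concatenation.
  refine ⟨(FundamentalGroup Y x₀)ᵐᵒᵖ, inferInstance, fun {a b} p => MulOpposite.op
    (FundamentalGroup.fromPath (c (.mk p))), ?_, ?_, ?_⟩
  · intro a b p q h
    exact congrArg (fun x => MulOpposite.op (FundamentalGroup.fromPath (c x)))
      (Path.Homotopic.Quotient.eq.2 h)
  · intro a b d p q
    exact congrArg MulOpposite.op (hmul (.mk p) (.mk q))
  · intro p hp
    exact Path.Homotopic.Quotient.eq.1 (hone _ (MulOpposite.op_injective hp))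

theorem homotopic_of_mem_convex {G C : Set ℂ} (hC : Convex ℝ C) (hCG : C ⊆ G) {a b : G}
    (p q : Path a b) (hp : ∀ t, (p t : ℂ) ∈ C) (hq : ∀ t, (q t : ℂ) ∈ C) : p.Homotopic q := by
  have hmem : ∀ x : unitInterval × unitInterval,
      AffineMap.lineMap (p x.2 : ℂ) (q x.2 : ℂ) (x.1 : ℝ) ∈ C := fun x =>
    hC.segment_subset (hp x.2) (hq x.2) (by
      rw [segment_eq_image_lineMap]; exact ⟨x.1, x.1.2, rfl⟩)
  refine ⟨{
    toFun := fun x => ⟨AffineMap.lineMap (p x.2 : ℂ) (q x.2 : ℂ) (x.1 : ℝ), hCG (hmem x)⟩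
    continuous_toFun := ?_
    map_zero_left := by intro x; simp
    map_one_left := by intro x; simp
    prop' := ?_ }⟩
  · refine Continuous.subtype_mk ?_ _
    simp only [AffineMap.lineMap_apply]
    fun_prop
  · rintro t x (rfl | rfl)
    · simp
    · simp

/-- The straight path between two points whose segment lies in `G`. -/
noncomputable def segmentPath {G : Set ℂ} {a b : ℂ} (h : segment ℝ a b ⊆ G) :
    Path (⟨a, h (left_mem_segment ℝ a b)⟩ : G) ⟨b, h (right_mem_segment ℝ a b)⟩ where
  toFun t := ⟨AffineMap.lineMap a b (t : ℝ), h (by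
    rw [segment_eq_image_lineMap]; exact ⟨t, t.2, rfl⟩)⟩
  continuous_toFun := Continuous.subtype_mk (by simp only [AffineMap.lineMap_apply]; fun_prop) _
  source' := by simp
  target' := by simp

theorem segmentPath_mem {G : Set ℂ} {a b : ℂ} (h : segment ℝ a b ⊆ G) (t : unitInterval) :
    (segmentPath h t : ℂ) ∈ segment ℝ a b := by
  rw [segment_eq_image_lineMap]; exact ⟨t, t.2, rfl⟩

/-- A holonomy for `G` gives group elements to straight segments that are multiplicative on
convex subsets of `G` and compute the holonomy of paths in convex subsets of `G`. -/
theorem exists_segment_holonomy {G : Set ℂ} {Γ : Type} [Group Γ]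
    (Φ : ∀ {a b : G}, Path a b → Γ)
    (hom : ∀ {a b : G} (p q : Path a b), p.Homotopic q → Φ p = Φ q)
    (mul : ∀ {a b c : G} (p : Path a b) (q : Path b c), Φ (p.trans q) = Φ p * Φ q) :
    ∃ E : ℂ → ℂ → Γ,
      (∀ {C : Set ℂ}, Convex ℝ C → C ⊆ G → ∀ {a b : G} (p : Path a b), (∀ t, (p t : ℂ) ∈ C) →
        Φ p = E a b) ∧
      ∀ {C : Set ℂ}, Convex ℝ C → C ⊆ G → ∀ {a b c : ℂ}, a ∈ C → b ∈ C → c ∈ C →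
        E a b * E b c = E a c := by
  classical
  set E : ℂ → ℂ → Γ := fun a b => if h : segment ℝ a b ⊆ G then Φ (segmentPath h) else 1 with hE
  have hEpath : ∀ {C : Set ℂ}, Convex ℝ C → C ⊆ G → ∀ {a b : G} (p : Path a b),
      (∀ t, (p t : ℂ) ∈ C) → Φ p = E a b := by
    intro C hC hCG a b p hp
    have ha : (a : ℂ) ∈ C := by simpa using hp 0
    have hb : (b : ℂ) ∈ C := by simpa using hp 1
    have hseg : segment ℝ (a : ℂ) b ⊆ C := hC.segment_subset ha hb
    have hsegG := hseg.trans hCG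
    simp only [hE, dif_pos hsegG]
    exact hom _ _ (homotopic_of_mem_convex hC hCG _ _ hp fun t => hseg (segmentPath_mem hsegG t))
  refine ⟨E, hEpath, ?_⟩
  intro C hC hCG a b c ha hb hc
  have hab := hC.segment_subset ha hb
  have hbc := hC.segment_subset hb hc
  have h := hEpath hC hCG ((segmentPath (hab.trans hCG)).trans (segmentPath (hbc.trans hCG)))
    (fun t => by
      rw [Path.trans_apply]
      split_ifs
      · exact hab (segmentPath_mem _ _)
      · exact hbc (segmentPath_mem _ _))
  rw [mul] at h
  simp only [hE, dif_pos (hab.trans hCG), dif_pos (hbc.trans hCG)]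
  exact h

end Holonomy

/-! ### Bounded domains without holes are simply connected. -/

section SimplyConnected

/-- `a` is joined to `b` by a walk in `A` along which the product of `e` is `g`. -/
def JoinedBy {V Γ : Type*} [Monoid Γ] (A : V → V → Prop) (e : V → V → Γ) (a b : V) (g : Γ) :
    Prop :=
  ∃ l : List V, l.headD b = a ∧ (∀ s ∈ walkSteps l b, A s.1 s.2) ∧ walkProd e l b = g

theorem JoinedBy.trans {V Γ : Type*} [Monoid Γ] {A : V → V → Prop} {e : V → V → Γ} {a b c : V}
    {g g' : Γ} (h : JoinedBy A e a b g) (h' : JoinedBy A e b c g') :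
    JoinedBy A e a c (g * g') := by
  obtain ⟨l, hl, hA, rfl⟩ := h
  obtain ⟨l', hl', hA', rfl⟩ := h'
  cases l' with
  | nil =>
    obtain rfl : c = b := hl'
    exact ⟨l, hl, hA, by simp [walkProd, walkSteps]⟩
  | cons d l' =>
    obtain rfl : d = b := hl'
    refine ⟨l ++ d :: l', ?_, ?_, walkProd_append e l d l' c⟩
    · cases l
      · exact hl
      · exact hl
    · intro s hs
      rw [walkSteps_append, List.mem_append] at hs
      exact hs.elim (hA s) (hA' s)

theorem JoinedBy.refl {V Γ : Type*} [Monoid Γ] (A : V → V → Prop) (e : V → V → Γ) (a : V) :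
    JoinedBy A e a a 1 :=
  ⟨[], rfl, by simp [walkSteps], by simp [walkProd, walkSteps]⟩

theorem JoinedBy.single {V Γ : Type*} [Monoid Γ] {A : V → V → Prop} (e : V → V → Γ) {a b : V}
    (h : A a b) : JoinedBy A e a b (e a b) :=
  ⟨[a], rfl, by simpa [walkSteps] using h, by simp [walkProd, walkSteps]⟩

theorem FilledLattice.eq_one_of_joinedBy {A : ℤ × ℤ → ℤ × ℤ → Prop} {S : ℤ × ℤ → Prop} {N : ℤ}
    (h : FilledLattice A S N) {Γ : Type*} [Group Γ]
    {e : ℤ × ℤ → ℤ × ℤ → Γ} (hinv : ∀ a b, A a b → e a b * e b a = 1)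
    (hsq : ∀ i j, S (i, j) → e (i, j + 1) (i + 1, j + 1) * e (i + 1, j + 1) (i + 1, j) =
      e (i, j + 1) (i, j) * e (i, j) (i + 1, j)) {a : ℤ × ℤ} {g : Γ}
    (hg : JoinedBy A e a a g) : g = 1 := by
  obtain ⟨l, hl, hA, rfl⟩ := hg
  cases l with
  | nil => simp [walkProd, walkSteps]
  | cons b l =>
    obtain rfl : b = a := hl
    exact walkProd_closed_eq_one h e hinv hsq b l hA

/-- The corner `(b.1, a.2)` links the two points by at most two lattice steps inside `C`, where `E`
is multiplicative. -/
theorem joinedBy_of_near {G C : Set ℂ} {Γ : Type} [Group Γ] {E : ℂ → ℂ → Γ} {ε : ℝ}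
    (hE : ∀ {a b c : ℂ}, a ∈ C → b ∈ C → c ∈ C → E a b * E b c = E a c)
    (hC : Convex ℝ C) (hCG : C ⊆ G) {a b : ℤ × ℤ} (h1 : |a.1 - b.1| ≤ 1) (h2 : |a.2 - b.2| ≤ 1)
    (ha : latticePt ε a ∈ C) (hb : latticePt ε b ∈ C) (hm : latticePt ε (b.1, a.2) ∈ C) :
    JoinedBy (fun a b => LatticeAdj a b ∧ segment ℝ (latticePt ε a) (latticePt ε b) ⊆ G)
      (fun a b => E (latticePt ε a) (latticePt ε b)) a b (E (latticePt ε a) (latticePt ε b)) := by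
  have hstep : ∀ {c d : ℤ × ℤ}, latticePt ε c ∈ C → latticePt ε d ∈ C → (c = d ∨ LatticeAdj c d) →
      JoinedBy (fun a b => LatticeAdj a b ∧ segment ℝ (latticePt ε a) (latticePt ε b) ⊆ G)
      (fun a b => E (latticePt ε a) (latticePt ε b)) c d (E (latticePt ε c) (latticePt ε d)) := by
    intro c d hc hd h
    rcases h with rfl | h
    · rw [mul_eq_left.1 (hE hc hc hc)]
      exact .refl _ _ _
    · exact .single (fun a b => E (latticePt ε a) (latticePt ε b))
        ⟨h, (hC.segment_subset hc hd).trans hCG⟩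
  rw [← hE ha hm hb]
  obtain ⟨a₁, a₂⟩ := a
  obtain ⟨b₁, b₂⟩ := b
  simp only [abs_le] at h1 h2
  refine (hstep ha hm ?_).trans (hstep hm hb ?_)
  · simp only [LatticeAdj, Prod.mk.injEq, and_true, true_and]
    omega
  · simp only [LatticeAdj, Prod.mk.injEq, true_and]
    omega

/-- Each coordinate is within `2 * ε` of that of `z`. Allowing different `w` and `w'` covers the
corner used in `joinedBy_of_near`. -/
theorem latticePt_mem_ball {ε : ℝ} (hε : 0 < ε) {z w w' : ℂ} (hw : dist w z ≤ ε)
    (hw' : dist w' z ≤ ε) :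
    latticePt ε ((latticeFloor ε w).1, (latticeFloor ε w').2) ∈ Metric.ball z (5 * ε) := by
  have hfl : ∀ x : ℝ, |ε * (⌊x / ε⌋ : ℝ) - x| ≤ ε := by
    intro x
    have h1 := Int.floor_le (x / ε)
    have h2 := (Int.lt_floor_add_one (x / ε)).le
    rw [le_div_iff₀ hε] at h1
    rw [div_le_iff₀ hε] at h2
    rw [abs_le]
    constructor <;> nlinarith
  rw [Metric.mem_ball, dist_eq_norm]
  rw [dist_eq_norm] at hw hw'
  have h1 := (Complex.abs_re_le_norm _).trans hw
  have h2 := (Complex.abs_im_le_norm _).trans hw'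
  have h3 := hfl w.re
  have h4 := hfl w'.im
  refine (Complex.norm_le_abs_re_add_abs_im _).trans_lt ?_
  simp only [latticePt, latticeFloor, Complex.sub_re, Complex.sub_im] at *
  rw [abs_le] at h1 h2 h3 h4
  have h5 : |ε * (⌊w.re / ε⌋ : ℝ) - z.re| ≤ 2 * ε := by rw [abs_le]; constructor <;> linarith
  have h6 : |ε * (⌊w'.im / ε⌋ : ℝ) - z.im| ≤ 2 * ε := by rw [abs_le]; constructor <;> linarith
  linarith

theorem abs_floor_sub_floor_le {ε x y : ℝ} (hε : 0 < ε) (h : |x - y| ≤ ε) :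
    |⌊x / ε⌋ - ⌊y / ε⌋| ≤ 1 := by
  have hxy : |x / ε - y / ε| ≤ 1 := by
    rw [← sub_div, abs_div, abs_of_pos hε]
    exact (div_le_one hε).2 h
  rw [abs_le] at hxy
  have h1 := Int.floor_le (x / ε)
  have h2 := Int.lt_floor_add_one (x / ε)
  have h3 := Int.floor_le (y / ε)
  have h4 := Int.lt_floor_add_one (y / ε)
  have h5 : ⌊x / ε⌋ < ⌊y / ε⌋ + 2 := by
    have : (⌊x / ε⌋ : ℝ) < ⌊y / ε⌋ + 2 := by linarith
    exact_mod_cast this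
  have h6 : ⌊y / ε⌋ < ⌊x / ε⌋ + 2 := by
    have : (⌊y / ε⌋ : ℝ) < ⌊x / ε⌋ + 2 := by linarith
    exact_mod_cast this
  rw [abs_le]
  omega

/-- A fine subdivision of the loop is shadowed by a closed lattice walk in `G`. Up to conjugation by
the segment from `x₀` to the first lattice point, both have the same holonomy, and that of the walk
is trivial. -/
theorem HasNoHoles.homotopic_refl {G : Set ℂ} (h : HasNoHoles G) (hG : IsOpen G)
    (hb : Bornology.IsBounded G) [PathConnectedSpace G] (x₀ : G) (γ : Path x₀ x₀) :
    γ.Homotopic (Path.refl x₀) := by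
  obtain ⟨Γ, _, Φ, hom, mul, hΦ⟩ := exists_path_holonomy G x₀
  obtain ⟨E, hEpath, hEmul⟩ := exists_segment_holonomy Φ hom mul
  apply hΦ
  -- the mesh
  have hγc : Continuous fun t => (γ t : ℂ) := continuous_subtype_val.comp γ.continuous
  obtain ⟨δ, hδ, hδG⟩ := (isCompact_range hγc).exists_thickening_subset_open hG
    (by rintro _ ⟨t, rfl⟩; exact (γ t).2)
  have hball : ∀ t, Metric.ball (γ t : ℂ) δ ⊆ G := fun t =>
    (Metric.ball_subset_thickening (Set.mem_range_self t) δ).trans hδG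
  obtain ⟨ε, hε, rfl⟩ : ∃ ε, 0 < ε ∧ δ = 5 * ε := ⟨δ / 5, by positivity, by ring⟩
  obtain ⟨η, hη, hγη⟩ := Metric.uniformContinuous_iff.1
    (CompactSpace.uniformContinuous_of_continuous hγc) ε hε
  obtain ⟨n, hn⟩ := exists_nat_one_div_lt hη
  obtain ⟨N, hN⟩ := h.filledLattice hb hε
  -- the subdivision
  set t : ℕ → unitInterval := fun k => Set.projIcc 0 1 zero_le_one ((k : ℝ) / (n + 1)) with ht
  have ht0 : t 0 = 0 := by
    simp [ht]
  have htn : t (n + 1) = 1 := by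
    have : ((n + 1 : ℕ) : ℝ) / (n + 1) = 1 := by push_cast; field_simp
    simp only [ht, this]
    exact Set.projIcc_right _
  have hstep : ∀ k s, s ∈ Set.uIcc (t k) (t (k + 1)) → dist (γ s : ℂ) (γ (t k)) < ε := by
    intro k s hs
    apply hγη
    have hmono : t k ≤ t (k + 1) := Set.monotone_projIcc _ (by
      gcongr; simp)
    rw [Set.uIcc_of_le hmono] at hs
    have h1 : (t k : ℝ) ≤ s := hs.1
    have h2 : (s : ℝ) ≤ t (k + 1) := hs.2
    have h3 : |(t (k + 1) : ℝ) - t k| ≤ 1 / (n + 1) := by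
      refine (Set.abs_projIcc_sub_projIcc _).trans ?_
      rw [← sub_div, abs_div]
      push_cast
      rw [add_sub_cancel_left, abs_one, abs_of_pos (by positivity)]
    rw [Subtype.dist_eq, Real.dist_eq, abs_of_nonneg (by linarith)]
    linarith [le_abs_self ((t (k + 1) : ℝ) - t k)]
  set a : ℕ → ℤ × ℤ := fun k => latticeFloor ε (γ (t k)) with ha
  set p : ℕ → ℂ := fun k => latticePt ε (a k) with hp
  have hpball : ∀ k, p k ∈ Metric.ball (γ (t k) : ℂ) (5 * ε) := fun k =>
    latticePt_mem_ball hε (by simp [hε.le]) (by simp [hε.le])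
  have hclose : ∀ k, dist (γ (t (k + 1)) : ℂ) (γ (t k)) < ε := fun k =>
    hstep k _ Set.right_mem_uIcc
  have hcent : ∀ k, (γ (t k) : ℂ) ∈ Metric.ball (γ (t k) : ℂ) (5 * ε) := fun k =>
    Metric.mem_ball_self hδ
  have hinv : ∀ u v : ℂ, segment ℝ u v ⊆ G → E u v * E v u = 1 := by
    intro u v huv
    have hu := left_mem_segment ℝ u v
    have hv := right_mem_segment ℝ u v
    rw [hEmul (convex_segment u v) huv hu hv hu]
    exact mul_eq_left.1 (hEmul (convex_segment u v) huv hu hu hu)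
  -- The holonomy of the first `k` pieces is that of the walk to `p k`, corrected by the segments
  -- linking the endpoints to the lattice.
  have key : ∀ k, ∃ g, JoinedBy
      (fun a b => LatticeAdj a b ∧ segment ℝ (latticePt ε a) (latticePt ε b) ⊆ G)
      (fun a b => E (latticePt ε a) (latticePt ε b)) (a 0) (a k) g ∧
      Φ (γ.subpath (t 0) (t k)) = E (γ (t 0)) (p 0) * g * E (p k) (γ (t k)) := by
    intro k
    induction k with
    | zero =>
      refine ⟨1, .refl _ _ _, ?_⟩
      rw [mul_one, hEmul (convex_ball _ _) (hball (t 0)) (hcent 0) (hpball 0) (hcent 0)]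
      refine hEpath (convex_ball _ _) (hball (t 0)) _ fun s => ?_
      rw [Path.subpath_self]
      exact hcent 0
    | succ k ih =>
      obtain ⟨g, hg, hΦg⟩ := ih
      have hC := convex_ball (γ (t k) : ℂ) (5 * ε)
      have hsucc : (γ (t (k + 1)) : ℂ) ∈ Metric.ball (γ (t k) : ℂ) (5 * ε) :=
        Metric.mem_ball.2 ((hclose k).trans (by linarith))
      have hpsucc : p (k + 1) ∈ Metric.ball (γ (t k) : ℂ) (5 * ε) :=
        latticePt_mem_ball hε (hclose k).le (hclose k).le
      have hre : |(γ (t k) : ℂ).re - (γ (t (k + 1)) : ℂ).re| ≤ ε := by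
        rw [← Complex.sub_re]
        refine (Complex.abs_re_le_norm _).trans ?_
        rw [← dist_eq_norm, dist_comm]
        exact (hclose k).le
      have him : |(γ (t k) : ℂ).im - (γ (t (k + 1)) : ℂ).im| ≤ ε := by
        rw [← Complex.sub_im]
        refine (Complex.abs_im_le_norm _).trans ?_
        rw [← dist_eq_norm, dist_comm]
        exact (hclose k).le
      refine ⟨g * E (p k) (p (k + 1)), hg.trans (joinedBy_of_near (hEmul hC (hball _)) hC (hball _)
        (abs_floor_sub_floor_le hε hre) (abs_floor_sub_floor_le hε him) (hpball k) hpsucc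
        (latticePt_mem_ball hε (hclose k).le (by simp [hε.le]))), ?_⟩
      have hsub : Φ (γ.subpath (t k) (t (k + 1))) = E (γ (t k)) (γ (t (k + 1))) := by
        refine hEpath hC (hball _) _ fun s => ?_
        have hs : γ.subpath (t k) (t (k + 1)) s ∈ γ '' Set.uIcc (t k) (t (k + 1)) := by
          rw [← Path.range_subpath]; exact Set.mem_range_self s
        obtain ⟨s', hs', hs''⟩ := hs
        rw [← hs'']
        exact Metric.mem_ball.2 ((hstep k s' hs').trans (by linarith))
      rw [← hom _ _ ⟨Path.Homotopy.subpathTransSubpath γ (t 0) (t k) (t (k + 1))⟩, mul, hΦg, hsub,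
        mul_assoc _ (E (p k) _), hEmul hC (hball _) (hpball k) (hcent k) hsucc,
        ← hEmul hC (hball _) (hpball k) hpsucc hsucc]
      simp only [mul_assoc]
  obtain ⟨g, hg, hΦg⟩ := key (n + 1)
  have hγ0 : γ (t 0) = x₀ := by rw [ht0]; exact γ.source
  have hγn : γ (t (n + 1)) = x₀ := by rw [htn]; exact γ.target
  have ha0 : a (n + 1) = a 0 := by simp only [ha, hγ0, hγn]
  rw [ha0] at hg
  -- On a cell inside `G`, both routes around its boundary have the holonomy of the diagonal.
  have hg1 : g = 1 := hN.eq_one_of_joinedBy (fun a b hab => hinv _ _ hab.2) (fun i j hS => by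
    have hmem : ∀ {x : ℤ × ℤ}, i ≤ x.1 ∧ x.1 ≤ i + 1 → j ≤ x.2 ∧ x.2 ≤ j + 1 →
        latticePt ε x ∈ latticeCell ε (i, j) := fun h1 h2 => latticePt_mem_latticeCell hε h1 h2
    have hC := convex_latticeCell (ε := ε) (i, j)
    rw [hEmul hC hS (hmem (by simp) (by simp)) (hmem (by simp) (by simp))
      (hmem (by simp) (by simp)), hEmul hC hS (hmem (by simp) (by simp)) (hmem (by simp) (by simp))
      (hmem (by simp) (by simp))]) hg
  have hp0 : p (n + 1) = p 0 := by simp only [hp, ha0]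
  have hloop : Φ (γ.subpath (t 0) (t (n + 1))) = 1 := by
    rw [hΦg, hg1, mul_one, hp0, hγn.trans hγ0.symm]
    exact hinv _ _ (((convex_ball _ _).segment_subset (hcent 0) (hpball 0)).trans (hball _))
  have hcast : ∀ {x y : G} (hx : x = x₀) (hy : y = x₀), Φ (γ.cast hx hy) = Φ γ := by
    rintro x y rfl rfl; rfl
  have hΦ01 : Φ (γ.subpath 0 1) = Φ γ := by
    rw [Path.subpath_zero_one]; exact hcast _ _
  rw [← hΦ01, ← hloop, ht0, htn]

theorem HasNoHoles.isSimplyConnected {G : Set ℂ} (h : HasNoHoles G) (hG : IsOpen G)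
    (hb : Bornology.IsBounded G) (hc : IsConnected G) : IsSimplyConnected G := by
  have : PathConnectedSpace G :=
    isPathConnected_iff_pathConnectedSpace.1 (hG.isConnected_iff_isPathConnected.1 hc)
  exact simply_connected_iff_loops_nullhomotopic.2 ⟨this, h.homotopic_refl hG hb⟩

end SimplyConnected

/-! ### The maximum modulus and its iterates. -/

section MaxModulus

variable {f : ℂ → ℂ} {R S : ℝ}

theorem IsTranscendentalEntire.not_constant (hf : IsTranscendentalEntire f) (c : ℂ) :
    ¬ ∀ z, f z = c := fun h => hf.2 ⟨Polynomial.C c, fun z => by simp [h z]⟩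

theorem norm_le_maxModulus (hf : IsTranscendentalEntire f) (z : ℂ) :
    ‖f z‖ ≤ maxModulus f ‖z‖ :=
  (isGreatest_maxModulus hf.1.continuous (norm_nonneg z)).2 ⟨z, by simp, rfl⟩

theorem exists_norm_eq_maxModulus (hf : IsTranscendentalEntire f) {r : ℝ} (hr : 0 ≤ r) :
    ∃ z : ℂ, ‖z‖ = r ∧ ‖f z‖ = maxModulus f r := by
  obtain ⟨z, hz, h⟩ := (isGreatest_maxModulus hf.1.continuous hr).1
  exact ⟨z, by simpa using hz, h⟩

theorem norm_lt_maxModulus (hf : IsTranscendentalEntire f) {z : ℂ} {r : ℝ} (hz : ‖z‖ < r) :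
    ‖f z‖ < maxModulus f r := by
  have hr : 0 < r := (norm_nonneg z).trans_lt hz
  have hle : ∀ w ∈ Metric.ball (0 : ℂ) r, ‖f w‖ ≤ maxModulus f r := fun w hw => by
    refine Complex.norm_le_of_forall_mem_frontier_norm_le Metric.isBounded_ball
      hf.1.diffContOnCl (fun y hy => ?_) (subset_closure hw)
    rw [frontier_ball _ hr.ne'] at hy
    rw [← mem_sphere_zero_iff_norm.1 hy]
    exact norm_le_maxModulus hf y
  have hzb : z ∈ Metric.ball (0 : ℂ) r := mem_ball_zero_iff.2 hz
  refine (hle z hzb).lt_of_ne fun heq => ?_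
  have hmax : IsMaxOn (norm ∘ f) (Metric.ball (0 : ℂ) r) z := fun w hw => by
    simpa [heq] using hle w hw
  have hconst := Complex.eqOn_of_isPreconnected_of_isMaxOn_norm
    (convex_ball (0 : ℂ) r).isPreconnected Metric.isOpen_ball hf.1.differentiableOn hzb hmax
  have hev : f =ᶠ[𝓝 z] Function.const ℂ (f z) :=
    hconst.eventuallyEq_of_mem (Metric.isOpen_ball.mem_nhds hzb)
  have han : AnalyticOnNhd ℂ f Set.univ := hf.1.differentiableOn.analyticOnNhd isOpen_univ
  have := han.eq_of_eventuallyEq (g := Function.const ℂ (f z)) analyticOnNhd_const hev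
  exact hf.not_constant (f z) fun w => congrFun this w

theorem maxModulus_nonneg (hf : IsTranscendentalEntire f) {r : ℝ} (hr : 0 ≤ r) :
    0 ≤ maxModulus f r := by
  obtain ⟨z, -, hz⟩ := exists_norm_eq_maxModulus hf hr
  exact hz ▸ norm_nonneg _

theorem maxModulus_mono (hf : IsTranscendentalEntire f) {r s : ℝ} (hr : 0 ≤ r) (hrs : r ≤ s) :
    maxModulus f r ≤ maxModulus f s := by
  rcases hrs.eq_or_lt with rfl | hlt
  · rfl
  · obtain ⟨z, hz, hfz⟩ := exists_norm_eq_maxModulus hf hr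
    exact hfz ▸ (norm_lt_maxModulus hf (hz ▸ hlt)).le

theorem maxModulus_iterate_mono (hf : IsTranscendentalEntire f) {r s : ℝ} (hr : 0 ≤ r)
    (hrs : r ≤ s) (n : ℕ) : (maxModulus f)^[n] r ≤ (maxModulus f)^[n] s := by
  suffices h : 0 ≤ (maxModulus f)^[n] r ∧ (maxModulus f)^[n] r ≤ (maxModulus f)^[n] s from h.2
  induction n with
  | zero => exact ⟨hr, hrs⟩
  | succ n ih =>
    simp only [Function.iterate_succ_apply']
    exact ⟨maxModulus_nonneg hf ih.1, maxModulus_mono hf ih.1 ih.2⟩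

theorem IsAdmissible.le_iterate (hR : IsAdmissible f R) (n : ℕ) : R ≤ (maxModulus f)^[n] R := by
  induction n with
  | zero => exact le_rfl
  | succ n ih =>
    rw [Function.iterate_succ_apply']
    exact ih.trans (hR.2 _ ih).le

theorem IsAdmissible.iterate (hR : IsAdmissible f R) (n : ℕ) :
    IsAdmissible f ((maxModulus f)^[n] R) :=
  ⟨hR.1.trans_le (hR.le_iterate n), fun r hr => hR.2 r ((hR.le_iterate n).trans hr)⟩

theorem IsAdmissible.iterate_monotone (hR : IsAdmissible f R) :
    Monotone fun n => (maxModulus f)^[n] R :=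
  monotone_nat_of_le_succ fun n => by
    simp only [Function.iterate_succ_apply']
    exact (hR.2 _ (hR.le_iterate n)).le

/-- A finite limit `l` would satisfy `M(l) > l`. Moving a maximum point of the circle of radius `l`
along its ray to the radius `M^n(R)` gives `M^(n+1)(R) > l` for some `n`. -/
theorem IsAdmissible.tendsto_iterate (hf : IsTranscendentalEntire f) (hR : IsAdmissible f R) :
    Tendsto (fun n => (maxModulus f)^[n] R) atTop atTop := by
  rcases tendsto_atTop_of_monotone hR.iterate_monotone with h | ⟨l, hl⟩
  · exact h
  exfalso
  have hle : ∀ n, (maxModulus f)^[n] R ≤ l := fun n => hR.iterate_monotone.ge_of_tendsto hl n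
  have hRl : R ≤ l := hle 0
  have hl0 : 0 < l := hR.1.trans_le hRl
  obtain ⟨z, hz, hfz⟩ := exists_norm_eq_maxModulus hf hl0.le
  have hlt : l < ‖f z‖ := hfz ▸ hR.2 l hRl
  have hcont : Tendsto (fun t : ℝ => ‖f ((t / l : ℝ) * z)‖) (𝓝 l) (𝓝 ‖f z‖) := by
    have hc : Continuous fun t : ℝ => ‖f ((t / l : ℝ) * z)‖ :=
      (hf.1.continuous.comp (by fun_prop)).norm
    have := hc.tendsto l
    rwa [div_self hl0.ne', Complex.ofReal_one, one_mul] at this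
  obtain ⟨n, hn⟩ := ((hcont.comp hl).eventually_const_lt hlt).exists
  have hnorm : ‖(((maxModulus f)^[n] R / l : ℝ) : ℂ) * z‖ = (maxModulus f)^[n] R := by
    rw [norm_mul, Complex.norm_real, hz, Real.norm_of_nonneg
      (div_nonneg (hR.iterate n).1.le hl0.le), div_mul_cancel₀ _ hl0.ne']
  have h1 := norm_le_maxModulus hf ((((maxModulus f)^[n] R / l : ℝ) : ℂ) * z)
  rw [hnorm, ← Function.iterate_succ_apply' (maxModulus f)] at h1
  exact absurd (hle (n + 1)) (not_le.2 (lt_of_lt_of_le hn h1))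

theorem norm_iterate_lt (hf : IsTranscendentalEntire f) {z : ℂ} {m n k : ℕ}
    (h : ‖f^[n] z‖ < (maxModulus f)^[m] R) :
    ‖f^[n + k] z‖ < (maxModulus f)^[m + k] R := by
  induction k with
  | zero => exact h
  | succ k ih =>
    rw [← add_assoc, ← add_assoc, Function.iterate_succ_apply', Function.iterate_succ_apply']
    exact norm_lt_maxModulus hf ih

end MaxModulus

/-! ### The sets A_R(f), their preimages, and the exhausting domains. -/

section Levels

variable {f : ℂ → ℂ} {R S : ℝ}

/-- The points whose orbit, after `L` steps, is at least as fast as the iterates of the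
maximum modulus: the preimage of `A_R(f)` under `f^L`. -/
def fastLevelPreimage (f : ℂ → ℂ) (R : ℝ) (L : ℕ) : Set ℂ :=
  {z | ∀ n : ℕ, (maxModulus f)^[n] R ≤ ‖f^[n + L] z‖}

theorem fastLevelPreimage_subset (L : ℕ) : fastLevelPreimage f R L ⊆ fastEscapingSet f R :=
  fun _ hz => ⟨L, hz⟩

theorem fastLevelPreimage_monotone (hR : IsAdmissible f R) :
    Monotone (fastLevelPreimage f R) := monotone_nat_of_le_succ fun L z hz n => by
  have := hz (n + 1)
  rw [show n + 1 + L = n + (L + 1) by omega] at this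
  exact (hR.iterate_monotone n.le_succ).trans this

theorem isClosed_fastLevelPreimage (hf : IsTranscendentalEntire f) (L : ℕ) :
    IsClosed (fastLevelPreimage f R L) := by
  simp only [fastLevelPreimage, Set.ofPred_forall]
  exact isClosed_iInter fun n =>
    isClosed_le continuous_const (hf.1.continuous.iterate _).norm

theorem isClosed_fastEscapingLevel (hf : IsTranscendentalEntire f) :
    IsClosed (fastEscapingLevel f R) := isClosed_fastLevelPreimage hf 0

theorem fastEscapingLevel_antitone (hf : IsTranscendentalEntire f) (hR : 0 ≤ R) (hRS : R ≤ S) :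
    fastEscapingLevel f S ⊆ fastEscapingLevel f R := fun _ hz n =>
  (maxModulus_iterate_mono hf hR hRS n).trans (hz n)

theorem iterate_mem_fastEscapingLevel {z : ℂ} (hz : z ∈ fastEscapingLevel f R) (n : ℕ) :
    f^[n] z ∈ fastEscapingLevel f ((maxModulus f)^[n] R) := fun k => by
  rw [← Function.iterate_add_apply, ← Function.iterate_add_apply]
  exact hz (k + n)

/-- The continuum principle applies to `f^[n + L]` because an orbit that has fallen behind cannot
catch up. -/
theorem exists_isPreconnected_fastLevelPreimage (hf : IsTranscendentalEntire f) {L : ℕ} {z : ℂ}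
    (hz : z ∈ fastLevelPreimage f R L) {U : Set ℂ} (hU : IsOpen U)
    (hb : Bornology.IsBounded U) (hzU : z ∈ U) :
    ∃ C : Set ℂ, IsPreconnected C ∧ z ∈ C ∧ C ⊆ fastLevelPreimage f R L ∧
      (C ∩ frontier U).Nonempty := by
  refine exists_isPreconnected_meets_frontier (g := fun n => f^[n + L])
    (fun n => hf.1.iterate _) (fun n w hw => ?_) hz hU hb hzU
  by_contra hlt
  have := norm_iterate_lt hf (k := 1) (not_le.1 hlt)
  rw [show n + L + 1 = n + 1 + L by omega] at this
  exact absurd hw (not_le.2 this)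

theorem hasNoHoles_compl_fastEscapingLevel (hf : IsTranscendentalEntire f) :
    HasNoHoles (fastEscapingLevel f R)ᶜ := by
  intro U hU hb hfr p hp hpA
  obtain ⟨C, -, -, hC, y, hyC, hyU⟩ := exists_isPreconnected_fastLevelPreimage (L := 0) hf hpA hU hb hp
  exact hfr hyU (hC hyC)

theorem ball_subset_compl_fastEscapingLevel :
    Metric.ball (0 : ℂ) R ⊆ (fastEscapingLevel f R)ᶜ := fun z hz hzA => by
  have := hzA 0
  simp only [Function.iterate_zero, id] at this
  exact absurd (mem_ball_zero_iff.1 hz) (not_lt.2 this)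

theorem isOpenMap_iterate (hf : IsTranscendentalEntire f) (n : ℕ) : IsOpenMap f^[n] := by
  have han : AnalyticOnNhd ℂ f Set.univ := hf.1.differentiableOn.analyticOnNhd isOpen_univ
  have hopen : IsOpenMap f := by
    rcases han.is_constant_or_isOpenMap with ⟨w, hw⟩ | h
    · exact absurd hw (hf.not_constant w)
    · exact h
  induction n with
  | zero => exact IsOpenMap.id
  | succ n ih => exact ih.comp hopen

/-- If `A_R(f)ᶜ` has a bounded component, then the component of `0` in the complement of
`A_{M^n(R)}(f)` is bounded for all large `n`. -/
theorem exists_isBounded_component (hf : IsTranscendentalEntire f)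
    (hcomp : HasBoundedComponent (fastEscapingLevel f R)ᶜ) :
    ∃ N, ∀ n ≥ N, Bornology.IsBounded
      (connectedComponentIn (fastEscapingLevel f ((maxModulus f)^[n] R))ᶜ 0) := by
  obtain ⟨z, hz, hb⟩ := hcomp
  set G₀ := connectedComponentIn (fastEscapingLevel f R)ᶜ z with hG₀
  have hopen : IsOpen (fastEscapingLevel f R)ᶜ := (isClosed_fastEscapingLevel hf).isOpen_compl
  have hz' : ∃ N, ‖f^[N] z‖ < (maxModulus f)^[N] R := by
    by_contra h
    push Not at h
    exact hz h
  obtain ⟨N, hN⟩ := hz'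
  refine ⟨N, fun n hn => ?_⟩
  set ρ := (maxModulus f)^[n] R
  set H := connectedComponentIn (fastEscapingLevel f ρ)ᶜ 0
  have hlt : ‖f^[n] z‖ < ρ := by
    have := norm_iterate_lt hf (k := n - N) hN
    rwa [Nat.add_sub_cancel' hn] at this
  have hρ : 0 < ρ := (norm_nonneg _).trans_lt hlt
  have hzH : f^[n] z ∈ H :=
    (convex_ball (0 : ℂ) ρ).isPreconnected.subset_connectedComponentIn (Metric.mem_ball_self hρ)
      ball_subset_compl_fastEscapingLevel (mem_ball_zero_iff.2 hlt)
  have hcont : Continuous f^[n] := hf.1.continuous.iterate n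
  have hcpt : IsCompact (f^[n] '' closure G₀) := hb.isCompact_closure.image hcont
  have hGimg : f^[n] '' G₀ ⊆ f^[n] '' closure G₀ := Set.image_mono subset_closure
  refine hcpt.isBounded.subset (Set.Subset.trans ?_ hGimg)
  -- `H` meets `f^[n] '' G₀` and cannot cross its boundary: by openness of `f^[n]` this comes from
  -- the boundary of `G₀`, so it lies in the level set of `ρ`.
  refine subset_of_disjoint_frontier isPreconnected_connectedComponentIn
    ⟨_, hzH, z, mem_connectedComponentIn hz, rfl⟩ ?_
  rw [Set.disjoint_left]
  intro y hyH hyf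
  obtain ⟨x, hx, rfl⟩ := closure_minimal hGimg hcpt.isClosed hyf.1
  rw [((isOpenMap_iterate hf n) _ hopen.connectedComponentIn).frontier_eq] at hyf
  have hxG : x ∉ G₀ := fun h => hyf.2 ⟨x, h, rfl⟩
  have hxA : x ∈ fastEscapingLevel f R := by
    by_contra hxA
    have hxf : x ∈ frontier G₀ := by
      rw [hopen.connectedComponentIn.frontier_eq]
      exact ⟨hx, hxG⟩
    exact frontier_connectedComponentIn_subset hopen z hxf hxA
  exact connectedComponentIn_subset _ _ hyH (iterate_mem_fastEscapingLevel hxA n)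

/-- The exhaustion of the plane by fundamental holes of the sets `A_{M^n(R)}(f)`. -/
theorem exists_exhaustion (hf : IsTranscendentalEntire f) (hR : IsAdmissible f R)
    (hcomp : HasBoundedComponent (fastEscapingLevel f R)ᶜ) :
    ∃ G : ℕ → Set ℂ,
      (∀ n, IsOpen (G n) ∧ IsSimplyConnected (G n) ∧ Bornology.IsBounded (G n)) ∧
      (∀ n, IsPreconnected (frontier (G n))) ∧ Monotone G ∧
      (∀ n, frontier (G n) ⊆ fastEscapingLevel f ((maxModulus f)^[n] R)) ∧
      ∀ n, Metric.ball 0 ((maxModulus f)^[n] R) ⊆ G n := by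
  obtain ⟨N, hN⟩ := exists_isBounded_component hf hcomp
  set ρ : ℕ → ℝ := fun n => (maxModulus f)^[n] R with hρ
  set O : ℕ → Set ℂ := fun n => (fastEscapingLevel f (ρ n))ᶜ with hO
  have hOo : ∀ n, IsOpen (O n) := fun n => (isClosed_fastEscapingLevel hf).isOpen_compl
  have hanti : ∀ m n, m ≤ n → fastEscapingLevel f (ρ n) ⊆ fastEscapingLevel f (ρ m) :=
    fun m n hmn => fastEscapingLevel_antitone hf (hR.iterate m).1.le (hR.iterate_monotone hmn)
  have h0 : ∀ n, (0 : ℂ) ∈ O n := fun n =>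
    ball_subset_compl_fastEscapingLevel (Metric.mem_ball_self (hR.iterate n).1)
  have hholes : ∀ n, HasNoHoles (connectedComponentIn (O n) 0) := fun n =>
    (hasNoHoles_compl_fastEscapingLevel hf).of_connectedComponentIn (hOo n) 0
  have hb : ∀ n, Bornology.IsBounded (connectedComponentIn (O (N + n)) 0) := fun n =>
    hN _ (Nat.le_add_right N n)
  refine ⟨fun n => connectedComponentIn (O (N + n)) 0,
    fun n => ⟨(hOo _).connectedComponentIn, (hholes _).isSimplyConnected
      (hOo _).connectedComponentIn (hb n) (isConnected_connectedComponentIn_iff.2 (h0 _)), hb n⟩,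
    fun n => (hholes _).isPreconnected_frontier (hOo _).connectedComponentIn (hb n)
      isPreconnected_connectedComponentIn,
    fun m n hmn => connectedComponentIn_mono 0
      (Set.compl_subset_compl.2 (hanti _ _ (Nat.add_le_add_left hmn N))),
    fun n y hy => ?_, fun n => ?_⟩
  · refine hanti n (N + n) (Nat.le_add_left n N) ?_
    have := frontier_connectedComponentIn_subset (hOo (N + n)) 0 hy
    simpa [hO] using this
  · refine (Metric.ball_subset_ball (hR.iterate_monotone (Nat.le_add_left n N))).trans ?_
    exact (convex_ball (0 : ℂ) _).isPreconnected.subset_connectedComponentIn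
      (Metric.mem_ball_self (hR.iterate _).1) ball_subset_compl_fastEscapingLevel

end Levels

/-! ### Connectedness of the three sets. -/

section SpidersWeb

variable {f : ℂ → ℂ} {R S : ℝ}

/-- Two points are joined through the connected boundary of one `G k` that contains both. -/
theorem isPreconnected_of_exhaustion {E : Set ℂ} {G : ℕ → Set ℂ}
    (hE : ∀ z ∈ E, ∀ U : Set ℂ, IsOpen U → Bornology.IsBounded U → z ∈ U →
      ∃ C ⊆ E, IsPreconnected C ∧ z ∈ C ∧ (C ∩ frontier U).Nonempty)
    (hG : ∀ n, IsOpen (G n) ∧ Bornology.IsBounded (G n)) (hmono : Monotone G)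
    (hfc : ∀ n, IsPreconnected (frontier (G n))) (hfE : ∀ n, frontier (G n) ⊆ E)
    (huniv : ⋃ n, G n = Set.univ) : IsPreconnected E := by
  refine isPreconnected_of_forall_pair fun x hx y hy => ?_
  obtain ⟨m, hm⟩ := Set.mem_iUnion.1 (huniv ▸ Set.mem_univ x)
  obtain ⟨n, hn⟩ := Set.mem_iUnion.1 (huniv ▸ Set.mem_univ y)
  set k := max m n
  obtain ⟨C, hCE, hC, hxC, p, hpC, hp⟩ :=
    hE x hx (G k) (hG k).1 (hG k).2 (hmono (le_max_left m n) hm)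
  obtain ⟨D, hDE, hD, hyD, q, hqD, hq⟩ :=
    hE y hy (G k) (hG k).1 (hG k).2 (hmono (le_max_right m n) hn)
  refine ⟨(C ∪ frontier (G k)) ∪ D, Set.union_subset (Set.union_subset hCE (hfE k)) hDE,
    Or.inl (Or.inl hxC), Or.inr hyD, ?_⟩
  exact (hC.union p hpC hp (hfc k)).union q (Or.inr hq) hqD hD

theorem fastEscapingSet_subset_escapingSet (hf : IsTranscendentalEntire f)
    (hR : IsAdmissible f R) : fastEscapingSet f R ⊆ escapingSet f := by
  rintro z ⟨L, hL⟩
  have h : Tendsto (fun n => ‖f^[n + L] z‖) atTop atTop :=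
    tendsto_atTop_mono hL (hR.tendsto_iterate hf)
  exact tendsto_norm_atTop_iff_cobounded.1 ((tendsto_add_atTop_iff_nat L).1 h)

/-- A point of `I(f)` outside `A(f)` lies in a decreasing intersection of compact sets that is
contained in `I(f)`, where the boundaries of the sets are in `A(f)`. -/
theorem exists_compacts_of_mem_escapingSet (hf : IsTranscendentalEntire f) (hR : IsAdmissible f R)
    {G : ℕ → Set ℂ} (hG : ∀ n, IsOpen (G n) ∧ Bornology.IsBounded (G n))
    (hfG : ∀ n, frontier (G n) ⊆ fastEscapingLevel f R)
    (hball : ∀ n, Metric.ball 0 ((maxModulus f)^[n] R) ⊆ G n) {z : ℂ}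
    (hz : z ∈ escapingSet f) (hzA : z ∉ fastEscapingSet f R) :
    ∃ K : ℕ → Set ℂ, Antitone K ∧ (∀ n, IsCompact (K n)) ∧ (∀ n, IsPreconnected (K n)) ∧
      (∀ n, z ∈ K n) ∧ (∀ n, (K n ∩ fastEscapingSet f R).Nonempty) ∧
      ⋂ n, K n ⊆ escapingSet f := by
  set V : ℕ → Set ℂ := fun n => connectedComponentIn (fastLevelPreimage f R n)ᶜ z with hV
  have hzn : ∀ n, z ∈ (fastLevelPreimage f R n)ᶜ := fun n h => hzA (fastLevelPreimage_subset n h)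
  have hzV : ∀ n, z ∈ V n := fun n => mem_connectedComponentIn (hzn n)
  have hVc : ∀ n, IsPreconnected (V n) := fun n => isPreconnected_connectedComponentIn
  have hanti : Antitone V := fun m n hmn =>
    connectedComponentIn_mono z (Set.compl_subset_compl.2 (fastLevelPreimage_monotone hR hmn))
  have hVb : ∀ n, Bornology.IsBounded (V n) := fun n => by
    obtain ⟨k, hk⟩ := ((hR.tendsto_iterate hf).eventually_gt_atTop ‖z‖).exists
    refine (hG k).2.subset ((hanti n.zero_le).trans (subset_of_disjoint_frontier (hVc 0)
      ⟨z, hzV 0, hball k (mem_ball_zero_iff.2 hk)⟩ (Set.disjoint_left.2 fun y hy hyG => ?_)))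
    exact connectedComponentIn_subset _ _ hy (hfG k hyG)
  refine ⟨fun n => closure (V n), fun m n hmn => closure_mono (hanti hmn),
    fun n => (hVb n).isCompact_closure, fun n => (hVc n).closure,
    fun n => subset_closure (hzV n), fun n => ?_, fun w hw => ?_⟩
  · obtain ⟨y, hy⟩ := frontier_nonempty_of_isBounded (hVb n) ⟨z, hzV n⟩
    have hyA := frontier_connectedComponentIn_subset
      (isClosed_fastLevelPreimage hf n).isOpen_compl z hy
    rw [compl_compl] at hyA
    exact ⟨y, hy.1, fastLevelPreimage_subset n hyA⟩
  · refine tendsto_norm_atTop_iff_cobounded.1 (tendsto_atTop.2 fun b => ?_)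
    obtain ⟨k, hk⟩ := ((hR.tendsto_iterate hf).eventually_ge_atTop b).exists
    have hev : ∀ᶠ n in atTop, f^[n] z ∈ (G k)ᶜ := hz (Bornology.isBounded_def.1 (hG k).2)
    filter_upwards [hev] with n hn
    -- The connected set `f^[n] '' V n` misses A_R(f), hence the boundary of `G k`; it contains
    -- `f^[n] z`, which is outside `G k`.
    have hmaps : V n ⊆ f^[n] ⁻¹' (G k)ᶜ := by
      intro v hv hvG
      refine hn (subset_of_disjoint_frontier
        ((hVc n).image _ (hf.1.continuous.iterate n).continuousOn) ⟨_, ⟨v, hv, rfl⟩, hvG⟩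
        (Set.disjoint_left.2 ?_) ⟨z, hzV n, rfl⟩)
      rintro _ ⟨x, hx, rfl⟩ hxG
      refine connectedComponentIn_subset _ _ hx fun j => ?_
      rw [Function.iterate_add_apply]
      exact hfG k hxG j
    have hwG : f^[n] w ∉ G k := closure_minimal hmaps
      ((hG k).1.isClosed_compl.preimage (hf.1.continuous.iterate n)) (Set.mem_iInter.1 hw n)
    refine hk.trans (not_lt.1 fun hlt => hwG (hball k (mem_ball_zero_iff.2 hlt)))

/-- If an open separation had A(f) in `u` and a point `z` of I(f) in `v`, the continuum through `z`
would lie in `v`. By compactness so would some `K n`, which meets A(f). -/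
theorem isPreconnected_escapingSet (hf : IsTranscendentalEntire f) (hR : IsAdmissible f R)
    {G : ℕ → Set ℂ} (hG : ∀ n, IsOpen (G n) ∧ Bornology.IsBounded (G n))
    (hfG : ∀ n, frontier (G n) ⊆ fastEscapingLevel f R)
    (hball : ∀ n, Metric.ball 0 ((maxModulus f)^[n] R) ⊆ G n)
    (hA : IsPreconnected (fastEscapingSet f R)) : IsPreconnected (escapingSet f) := by
  have hAI := fastEscapingSet_subset_escapingSet hf hR
  have key : ∀ u v : Set ℂ, IsOpen u → IsOpen v → escapingSet f ⊆ u ∪ v →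
      escapingSet f ∩ (u ∩ v) = ∅ → fastEscapingSet f R ⊆ u → escapingSet f ⊆ u := by
    intro u v hu hv huv hd hAu z hz
    by_contra hzu
    obtain ⟨K, hKa, hKc, hKp, hzK, hKA, hKI⟩ :=
      exists_compacts_of_mem_escapingSet hf hR hG hfG hball hz (fun h => hzu (hAu h))
    have hKv : ⋂ n, K n ⊆ v := by
      refine (isPreconnected_iff_subset_of_disjoint.1
        (isPreconnected_iInter_of_antitone hKa hKc hKp) u v hu hv (hKI.trans huv)
        (Set.subset_empty_iff.1 (hd ▸ Set.inter_subset_inter_left _ hKI))).resolve_left fun h =>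
        hzu (h (Set.mem_iInter.2 hzK))
    obtain ⟨n, hn⟩ := exists_subset_nhds_of_isCompact hKa.directed_ge hKc
      (fun x hx => hv.mem_nhds (hKv hx))
    obtain ⟨y, hyK, hyA⟩ := hKA n
    exact (hd ▸ ⟨hAI hyA, hAu hyA, hn hyK⟩ : y ∈ (∅ : Set ℂ))
  rw [isPreconnected_iff_subset_of_disjoint]
  intro u v hu hv huv hd
  rcases isPreconnected_iff_subset_of_disjoint.1 hA u v hu hv (hAI.trans huv)
    (Set.subset_empty_iff.1 (hd ▸ Set.inter_subset_inter_left _ hAI)) with h | h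
  · exact Or.inl (key u v hu hv huv hd h)
  · exact Or.inr (key v u hv hu (by rwa [Set.union_comm]) (by rwa [Set.inter_comm v u]) h)

end SpidersWeb

end FastEscaping

theorem theorem1p4 (f : ℂ → ℂ) (hf : FastEscaping.IsTranscendentalEntire f)
    (R : ℝ) (hR : FastEscaping.IsAdmissible f R)
    (hcomp : FastEscaping.HasBoundedComponent (FastEscaping.fastEscapingLevel f R)ᶜ) :
    FastEscaping.IsSpidersWeb (FastEscaping.fastEscapingLevel f R) ∧
    (∀ S : ℝ, FastEscaping.IsAdmissible f S →
      FastEscaping.IsSpidersWeb (FastEscaping.fastEscapingSet f S)) ∧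
    FastEscaping.IsSpidersWeb (FastEscaping.escapingSet f) := by
  open FastEscaping in
  obtain ⟨G, hG, hfc, hmono, hfr, hball⟩ := exists_exhaustion hf hR hcomp
  have hunion : ∀ k, ⋃ n, G (n + k) = Set.univ := fun k => Set.eq_univ_of_forall fun z => by
    obtain ⟨n, hn⟩ := ((hR.tendsto_iterate hf).eventually_gt_atTop ‖z‖).exists
    exact Set.mem_iUnion.2 ⟨n, hmono (Nat.le_add_right n k) (hball n (mem_ball_zero_iff.2 hn))⟩
  have hGb : ∀ n, IsOpen (G n) ∧ Bornology.IsBounded (G n) := fun n => ⟨(hG n).1, (hG n).2.2⟩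
  have hfrR : ∀ n, frontier (G n) ⊆ fastEscapingLevel f R := fun n =>
    (hfr n).trans (fastEscapingLevel_antitone hf hR.1.le (hR.le_iterate n))
  have hne : ∀ n, (frontier (G n)).Nonempty := fun n =>
    frontier_nonempty_of_isBounded (hG n).2.2 (hG n).2.1.nonempty
  have hweb : ∀ (E : Set ℂ) (k : ℕ), IsPreconnected E → (∀ n, frontier (G (n + k)) ⊆ E) →
      IsSpidersWeb E := fun E k hE hfE =>
    ⟨⟨(hne (0 + k)).mono (hfE 0), hE⟩, fun n => G (n + k), fun n => hG _,
      fun n => hmono (by omega), hfE, hunion k⟩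
  have hfast : ∀ S, IsAdmissible f S → ∃ k, (∀ n, frontier (G (n + k)) ⊆ fastEscapingSet f S) ∧
      IsPreconnected (fastEscapingSet f S) := by
    intro S hS
    -- From index `k` on, `M^n(R) ≥ S`, so the boundaries of the domains lie in A_S(f).
    obtain ⟨k, hk⟩ := ((hR.tendsto_iterate hf).eventually_ge_atTop S).exists
    have hfk : ∀ n, frontier (G (n + k)) ⊆ fastEscapingSet f S := fun n =>
      ((hfr (n + k)).trans (fastEscapingLevel_antitone hf hS.1.le
        (hk.trans (hR.iterate_monotone (Nat.le_add_left k n))))).trans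
        (fastLevelPreimage_subset (R := S) 0)
    refine ⟨k, hfk, isPreconnected_of_exhaustion (G := fun n => G (n + k)) ?_ (fun n => hGb _)
      (fun m n hmn => hmono (Nat.add_le_add_right hmn k)) (fun n => hfc _) hfk (hunion k)⟩
    rintro z ⟨L, hL⟩ U hU hb hzU
    obtain ⟨C, hC, hzC, hCE, hCU⟩ := exists_isPreconnected_fastLevelPreimage hf hL hU hb hzU
    exact ⟨C, hCE.trans (fastLevelPreimage_subset L), hC, hzC, hCU⟩
  refine ⟨hweb _ 0 (isPreconnected_of_exhaustion (fun z hz U hU hb hzU => ?_) hGb hmono hfc hfrR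
    (hunion 0)) hfrR, fun S hS => ?_, ?_⟩
  · obtain ⟨C, hC, hzC, hCE, hCU⟩ :=
      exists_isPreconnected_fastLevelPreimage (L := 0) hf hz hU hb hzU
    exact ⟨C, hCE, hC, hzC, hCU⟩
  · obtain ⟨k, hk, hc⟩ := hfast S hS
    exact hweb _ k hc hk
  · obtain ⟨-, -, hc⟩ := hfast R hR
    exact hweb _ 0 (isPreconnected_escapingSet hf hR hGb hfrR hball hc) fun n =>
      (hfrR _).trans ((fastLevelPreimage_subset (R := R) 0).trans
        (fastEscapingSet_subset_escapingSet hf hR))
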